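/- All graphs are finite and simple. The join $G+H$ is obtained from vertex-disjoint copies of $G$ and $H$ by adding all edges between $V(G)$ and $V(H)$; $P_n$ is the path on $n$ vertices, $2P_1$ is the graph consisting of two isolated vertices, and $\Delta$ denotes the maximum degree. In a drawing of a graph in the plane, the vertices are distinct points and the edges are simple arcs joining their end vertices and passing through no other vertex; edges with a common end vertex do not cross, two edges have only finitely many common points, each common point of two edges that is not a vertex is a (transversal) crossing, and no three edges cross at one point. A drawing $D$ is 1-planar if each edge is crossed at most once. The associated plane graph $D^\times$ is obtained from a 1-planar drawing $D$ by turning each crossing into a new vertex of degree four, called a false vertex. A graph is of class $\mathcal C_0$ if it has a 1-planar drawing $D$ such that $N_{D^\times}(c_1)\cap N_{D^\times}(c_2)=\emptyset$ for any two distinct false vertices $c_1,c_2$ of $D^\times$. For $k\ge 6$ let $G_k$ be the graph obtained from the cycle $v_1v_2\dots v_kv_1$ by adding the edges $v_1v_3$ and $v_4v_6$, and let $G_k^-$ be the graph obtained from $G_k$ by removing the edge $v_3v_4$. **Lemma.** If $G+2P_1$ or $G+P_2$ is of class $\mathcal C_0$, then $\Delta(G)\le 3$. Moreover, this bound is tight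 in both cases: for every $k\ge 6$, $\Delta(G_k)=3$ and $G_k+2P_1$ is of class $\mathcal C_0$, and $\Delta(G_k^-)=3$ and $G_k^-+P_2$ is of class $\mathcal C_0$. -/

import Mathlib

open scoped SimpleGraph

namespace OnePlanar

universe u

/-- `A` is a (simple, Jordan) arc in the plane with end points `x` and `y`. -/
def IsArc (x y : ℝ × ℝ) (A : Set (ℝ × ℝ)) : Prop :=
  ∃ γ : Path x y, Function.Injective γ ∧ Set.range γ = A

theorem IsArc.symm {x y : ℝ × ℝ} {A : Set (ℝ × ℝ)} (h : IsArc x y A) : IsArc y x A := by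
  obtain ⟨γ, hγ, hA⟩ := h
  refine ⟨γ.symm, fun s t hst => ?_, by rw [Path.symm_range, hA]⟩
  exact unitInterval.symm_bijective.injective (hγ hst)

/-- The sets `A` and `B` cross (transversally, and not merely touch) at the point `p`: in suitable
local coordinates around `p` they are a horizontal and a vertical line through `p`. -/
def CrossAt (A B : Set (ℝ × ℝ)) (p : ℝ × ℝ) : Prop :=
  ∃ φ : OpenPartialHomeomorph (ℝ × ℝ) (ℝ × ℝ), p ∈ φ.source ∧ ∀ q ∈ φ.source,
    (q ∈ A ↔ (φ q).2 = (φ p).2) ∧ (q ∈ B ↔ (φ q).1 = (φ p).1)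

/-- A drawing of a graph in the plane: vertices are distinct points, edges are simple arcs joining
their end vertices and passing through no other vertex, edges with a common end vertex do not
cross, two edges have finitely many common points, each common point that is not a vertex is a
crossing, and no three edges cross at the same point. -/
structure Drawing {V : Type u} (G : SimpleGraph V) where
  pt : V → ℝ × ℝ
  arc : G.edgeSet → Set (ℝ × ℝ)
  pt_injective : Function.Injective pt
  isArc_arc : ∀ (a b : V) (h : G.Adj a b),
    IsArc (pt a) (pt b) (arc ⟨s(a, b), (SimpleGraph.mem_edgeSet G).2 h⟩)
  mem_of_pt_mem_arc : ∀ (e : G.edgeSet) (w : V), pt w ∈ arc e → w ∈ (e : Sym2 V)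
  adjacent_inter : ∀ (e f : G.edgeSet) (w : V), e ≠ f → w ∈ (e : Sym2 V) → w ∈ (f : Sym2 V) →
    arc e ∩ arc f ⊆ {pt w}
  finite_inter : ∀ e f : G.edgeSet, e ≠ f → (arc e ∩ arc f).Finite
  crossAt : ∀ (e f : G.edgeSet) (p : ℝ × ℝ), e ≠ f → p ∈ arc e → p ∈ arc f →
    p ∉ Set.range pt → CrossAt (arc e) (arc f) p
  no_triple : ∀ e f g : G.edgeSet, e ≠ f → e ≠ g → f ≠ g →
    arc e ∩ arc f ∩ arc g ⊆ Set.range pt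

namespace Drawing

variable {V : Type u} {G : SimpleGraph V}

/-- The crossings of a drawing, that is, the false vertices of the associated plane graph. -/
def crossings (D : Drawing G) : Set (ℝ × ℝ) :=
  {p | p ∉ Set.range D.pt ∧ ∃ e f : G.edgeSet, e ≠ f ∧ p ∈ D.arc e ∧ p ∈ D.arc f}

/-- A drawing is 1-planar if each edge is crossed at most once. -/
def IsOnePlanar (D : Drawing G) : Prop :=
  ∀ e : G.edgeSet, (D.arc e ∩ D.crossings).Subsingleton

/-- The position in the plane of a vertex (true or false) of the associated plane graph. -/
def pos (D : Drawing G) : V ⊕ D.crossings → ℝ × ℝ :=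
  Sum.elim D.pt Subtype.val

/-- The associated plane graph of a drawing: every crossing becomes a new (false) vertex, and two
vertices are adjacent if some part of a drawn edge joins them without passing through a third
vertex, true or false. -/
def associated (D : Drawing G) : SimpleGraph (V ⊕ D.crossings) where
  Adj x y := x ≠ y ∧ ∃ (e : G.edgeSet) (A : Set (ℝ × ℝ)), A ⊆ D.arc e ∧
    IsArc (D.pos x) (D.pos y) A ∧ ∀ z, D.pos z ∈ A → z = x ∨ z = y
  symm := ⟨fun _ _ h => by
    obtain ⟨hne, e, A, hA, harc, hz⟩ := h
    exact ⟨hne.symm, e, A, hA, harc.symm, fun z hzA => (hz z hzA).symm⟩⟩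
  loopless := ⟨fun _ h => h.1 rfl⟩

/-- A `C₀`-drawing: a 1-planar drawing such that any two different false vertices have no common
neighbour in the associated plane graph. -/
def IsC0 (D : Drawing G) : Prop :=
  D.IsOnePlanar ∧ ∀ c₁ c₂ : D.crossings, c₁ ≠ c₂ →
    (D.associated.neighborSet (Sum.inr c₁) ∩ D.associated.neighborSet (Sum.inr c₂)).encard = 0

end Drawing

/-- A graph is (1-planar) of class `C₀` if it has a `C₀`-drawing. -/
def ClassC0 {V : Type u} (G : SimpleGraph V) : Prop :=
  ∃ D : Drawing G, D.IsC0

/-- The join product `G + H`. -/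
def join {V W : Type*} (G : SimpleGraph V) (H : SimpleGraph W) : SimpleGraph (V ⊕ W) :=
  (G ⊕g H) ⊔ completeBipartiteGraph V W

/-- The disjoint union of two copies of the one-vertex path. -/
def twoP1 : SimpleGraph (Fin 1 ⊕ Fin 1) :=
  SimpleGraph.pathGraph 1 ⊕g SimpleGraph.pathGraph 1

/-- The path on two vertices. -/
def P2 : SimpleGraph (Fin 2) :=
  SimpleGraph.pathGraph 2

/-- The graph `G_k`: the cycle `v₁ v₂ … v_k v₁` with the chords `v₁v₃` and `v₄v₆`. The vertex
`vᵢ` is the element `i - 1` of `Fin k`. -/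
def cycleWithChords (k : ℕ) (hk : 6 ≤ k) : SimpleGraph (Fin k) :=
  SimpleGraph.cycleGraph k ⊔ SimpleGraph.edge ⟨0, by omega⟩ ⟨2, by omega⟩
    ⊔ SimpleGraph.edge ⟨3, by omega⟩ ⟨5, by omega⟩

/-- The graph `G_k⁻`, obtained from `G_k` by removing the edge `v₃v₄`. -/
def cycleWithChordsMinus (k : ℕ) (hk : 6 ≤ k) : SimpleGraph (Fin k) :=
  (cycleWithChords k hk).deleteEdges {s(⟨2, by omega⟩, ⟨3, by omega⟩)}

end OnePlanar

namespace OnePlanar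

universe u

/-! Upper bound: if a vertex `v` of `G` had four neighbours, then `v` and two vertices of the joined
graph would form with them a `K₃,₄`. Each `K₃,₃` inside it contains two crossing independent edges
(`k33_arcs`). Omitting a right vertex used by a first crossing gives a second crossing at a
different point. Each false vertex is adjacent to two of the three left vertices, so the two share a
neighbour, contrary to class `C₀` (`IsC0.not_k34`). The crossing in `K₃,₃` comes from winding
numbers: for disjoint arcs the difference of their parametrisations has a logarithm on the whole
parameter plane, so its increments around a square cancel. Normalising these increments gives an
integer relation for each of the 18 pairs of independent edges, and their sum is contradictory
modulo 2 (`k33_curves`). Tightness: an explicit straight-line drawing on integer points. The rim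
lies on a concave parabola except for vertex 4, moved just below the chord `3 5`; one hub lies above
all rim lines, the other just above the long edge joining `0` to `k - 1`. Only the chords `0 2` and
`3 5` are crossed, each by one spoke, and the two crossings involve eight distinct vertices. The
segment between the hubs meets only the rim edge `2 3`, which is why that edge is deleted for `P₂`.
All incidences are signs of `orient` (`straightC0_wheel`, `StraightC0.classC0`). -/

/-! ### Continuous logarithms and the nonplanarity of `K₃,₃`. -/

/-- A nowhere zero continuous function on a simply connected space has a continuous logarithm. -/
theorem exists_continuous_log {A : Type*} [TopologicalSpace A] [SimplyConnectedSpace A]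
    [LocallyPathConnectedSpace A] {f : A → ℂ} (hf : Continuous f) (h0 : ∀ a, f a ≠ 0) :
    ∃ g : A → ℂ, Continuous g ∧ ∀ a, Complex.exp (g a) = f a := by
  obtain ⟨a₀⟩ := (inferInstance : Nonempty A)
  obtain ⟨F, ⟨-, hF⟩, -⟩ := Complex.isCoveringMap_exp.existsUnique_continuousMap_lifts
    ⟨fun a => (⟨f a, h0 a⟩ : {z : ℂ // z ≠ 0}), by fun_prop⟩ a₀ (Complex.log (f a₀))
    (Subtype.ext (Complex.exp_log (h0 a₀)))
  exact ⟨F, F.continuous, fun a => congrArg Subtype.val (congrFun hF a)⟩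

/-- The exponential is a covering map, and lifts of a constant map along a covering are constant. -/
theorem eq_of_exp_const {h : ℝ → ℂ} (hc : Continuous h)
    (he : ∀ s t, Complex.exp (h s) = Complex.exp (h t)) (s t : ℝ) : h s = h t :=
  Complex.isCoveringMap_exp.const_of_comp hc (fun a b => Subtype.ext (he a b)) s t

/-- The increments of two continuous logarithms of proportional functions agree. -/
theorem log_increment_eq {f g : ℝ → ℂ} (hf : Continuous f) (hg : Continuous g) (c : ℂ)
    (h : ∀ t, Complex.exp (f t) = c * Complex.exp (g t)) : f 1 - f 0 = g 1 - g 0 := by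
  have key := eq_of_exp_const (h := fun t => f t - g t) (hf.sub hg) (fun s t => by
    simp [Complex.exp_sub, h]) 1 0
  linear_combination key

/-- A logarithm of `z` is obtained from one of `-z` by a half turn. -/
theorem exp_log_neg_add_pi {z : ℂ} (hz : z ≠ 0) :
    Complex.exp (Complex.log (-z) + Real.pi * Complex.I) = z := by
  rw [Complex.exp_add, Complex.exp_log (neg_ne_zero.2 hz), Complex.exp_pi_mul_I]; ring

theorem exists_int_of_exp_eq {a b c d : ℂ} (h1 : Complex.exp a = Complex.exp c)
    (h2 : Complex.exp b = Complex.exp d) :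
    ∃ n : ℤ, a - b = c - d + n * (2 * Real.pi * Complex.I) := by
  obtain ⟨n, hn⟩ := Complex.exp_eq_exp_iff_exists_int.1 h1
  obtain ⟨m, hm⟩ := Complex.exp_eq_exp_iff_exists_int.1 h2
  exact ⟨n - m, by rw [hn, hm]; push_cast; ring⟩

/-- `K₃,₃` has no drawing in the plane in which independent edges are disjoint. -/
theorem k33_curves (p q : Fin 3 → ℂ) (γ : Fin 3 → Fin 3 → ℝ → ℂ)
    (hγ : ∀ i j, Continuous (γ i j)) (h0 : ∀ i j, γ i j 0 = p i) (h1 : ∀ i j, γ i j 1 = q j)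
    (hd : ∀ i j k l s t, i ≠ k → j ≠ l → γ i j s ≠ γ k l t) : False := by
  have hpp : ∀ i k, i ≠ k → p k - p i ≠ 0 := fun i k hik => by
    have := hd k 0 i 1 0 0 hik.symm (by decide)
    rw [h0, h0] at this; exact sub_ne_zero.2 this
  have hqq : ∀ j l, j ≠ l → q l - q j ≠ 0 := fun j l hjl => by
    have := hd 0 l 1 j 1 1 (by decide) hjl.symm
    rw [h1, h1] at this; exact sub_ne_zero.2 this
  have hqp : ∀ i l, q l - p i ≠ 0 := fun i l => by
    obtain ⟨k, hk⟩ : ∃ k : Fin 3, k ≠ i := exists_ne i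
    obtain ⟨j, hj⟩ : ∃ j : Fin 3, j ≠ l := exists_ne l
    have := hd k l i j 1 0 hk hj.symm
    rw [h1, h0] at this; exact sub_ne_zero.2 this
  -- The value `0` on the diagonal `i = k` is a filler, so that the logarithms can be chosen as
  -- total families.
  have hA : ∀ i k l, ∃ g : ℝ → ℂ, i ≠ k → Continuous g ∧
      ∀ t, Complex.exp (g t) = γ k l t - p i := fun i k l => by
    by_cases hik : i = k
    · exact ⟨0, fun h => absurd hik h⟩
    · obtain ⟨j, hj⟩ : ∃ j : Fin 3, j ≠ l := exists_ne l
      obtain ⟨g, hg⟩ := exists_continuous_log (f := fun t => γ k l t - p i)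
        ((hγ k l).sub continuous_const) (fun t => sub_ne_zero.2 (by
          rw [← h0 i j]; exact hd k l i j t 0 (Ne.symm hik) hj.symm))
      exact ⟨g, fun _ => hg⟩
  have hB : ∀ j k l, ∃ g : ℝ → ℂ, j ≠ l → Continuous g ∧
      ∀ t, Complex.exp (g t) = γ k l t - q j := fun j k l => by
    by_cases hjl : j = l
    · exact ⟨0, fun h => absurd hjl h⟩
    · obtain ⟨i, hi⟩ : ∃ i : Fin 3, i ≠ k := exists_ne k
      obtain ⟨g, hg⟩ := exists_continuous_log (f := fun t => γ k l t - q j)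
        ((hγ k l).sub continuous_const) (fun t => sub_ne_zero.2 (by
          rw [← h1 i j]; exact hd k l i j t 1 hi.symm (Ne.symm hjl)))
      exact ⟨g, fun _ => hg⟩
  choose A hA using hA
  choose B hB using hB
  have hsq : ∀ i j k l, i ≠ k → j ≠ l →
      (A i k l 1 - A i k l 0) + (B l i j 1 - B l i j 0) =
        (A k i j 1 - A k i j 0) + (B j k l 1 - B j k l 0) := by
    intro i j k l hik hjl
    -- `G` is a logarithm on the whole plane; on each side of the unit square it differs by a
    -- constant from one of the chosen logarithms, since one curve is then at an end point.
    obtain ⟨G, hGc, hG⟩ := exists_continuous_log (A := ℝ × ℝ)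
      (f := fun z => γ i j z.1 - γ k l z.2)
      (((hγ i j).comp continuous_fst).sub ((hγ k l).comp continuous_snd))
      (fun z => sub_ne_zero.2 (hd i j k l z.1 z.2 hik hjl))
    have e1 := log_increment_eq (f := fun t => G (0, t)) (g := A i k l) (by fun_prop)
      (hA i k l hik).1 (-1) (fun t => by rw [hG, (hA i k l hik).2, h0]; ring)
    have e2 := log_increment_eq (f := fun t => G (1, t)) (g := B j k l) (by fun_prop)
      (hB j k l hjl).1 (-1) (fun t => by rw [hG, (hB j k l hjl).2, h1]; ring)
    have e3 := log_increment_eq (f := fun t => G (t, 0)) (g := A k i j) (by fun_prop)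
      (hA k i j hik.symm).1 1 (fun t => by rw [hG, (hA k i j hik.symm).2, h0]; ring)
    have e4 := log_increment_eq (f := fun t => G (t, 1)) (g := B l i j) (by fun_prop)
      (hB l i j hjl.symm).1 1 (fun t => by rw [hG, (hB l i j hjl.symm).2, h1]; ring)
    linear_combination -e1 - e4 + e3 + e2
  -- Logarithms of the directions between vertices of one class, normalised so that reversing an
  -- increasing pair adds exactly `πi`. This half turn produces the odd constant in `same`.
  let dir (r : Fin 3 → ℂ) (i k : Fin 3) : ℂ :=
    if i < k then Complex.log (r k - r i)
    else Complex.log (-(r k - r i)) + Real.pi * Complex.I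
  have hdir : ∀ (r : Fin 3 → ℂ) i k, r k - r i ≠ 0 →
      Complex.exp (dir r i k) = r k - r i := fun r i k h => by
    by_cases hik : i < k
    · simp only [dir, if_pos hik]; exact Complex.exp_log h
    · simp only [dir, if_neg hik]; exact exp_log_neg_add_pi h
  have hdir' : ∀ (r : Fin 3 → ℂ) i k, i < k →
      dir r k i = dir r i k + Real.pi * Complex.I := fun r i k h => by
    simp only [dir, if_pos h, if_neg h.not_gt, neg_sub]
  have ha : ∀ i k l, ∃ n : ℤ, i ≠ k → A i k l 1 - A i k l 0 =
      Complex.log (q l - p i) - dir p i k + n * (2 * Real.pi * Complex.I) := fun i k l => by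
    by_cases hik : i = k
    · exact ⟨0, fun h => absurd hik h⟩
    · obtain ⟨n, hn⟩ := exists_int_of_exp_eq (a := A i k l 1) (b := A i k l 0)
        (c := Complex.log (q l - p i)) (d := dir p i k)
        (by rw [(hA i k l hik).2, h1, Complex.exp_log (hqp i l)])
        (by rw [(hA i k l hik).2, h0, hdir p i k (hpp i k hik)])
      exact ⟨n, fun _ => hn⟩
  have hb : ∀ j k l, ∃ n : ℤ, j ≠ l → B j k l 1 - B j k l 0 =
      dir q j l - (Complex.log (q j - p k) + Real.pi * Complex.I)
        + n * (2 * Real.pi * Complex.I) := fun j k l => by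
    by_cases hjl : j = l
    · exact ⟨0, fun h => absurd hjl h⟩
    · obtain ⟨n, hn⟩ := exists_int_of_exp_eq (a := B j k l 1) (b := B j k l 0)
        (c := dir q j l) (d := Complex.log (q j - p k) + Real.pi * Complex.I)
        (by rw [(hB j k l hjl).2, h1, hdir q j l (hqq j l hjl)])
        (by
          rw [(hB j k l hjl).2, h0, ← neg_sub (p k), exp_log_neg_add_pi]
          rw [← neg_sub]; exact neg_ne_zero.2 (hqp k j))
      exact ⟨n, fun _ => hn⟩
  choose a ha using ha
  choose b hb using hb
  have hpi : (Real.pi * Complex.I : ℂ) ≠ 0 :=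
    mul_ne_zero (Complex.ofReal_ne_zero.2 Real.pi_ne_zero) Complex.I_ne_zero
  have same : ∀ i j k l, i < k → j < l →
      1 + (a i k l + b l i j - a k i j - b j k l) = 0 := fun i j k l hik hjl => by
    have h := hsq i j k l hik.ne hjl.ne
    rw [ha i k l hik.ne, ha k i j hik.ne', hb l i j hjl.ne', hb j k l hjl.ne,
      hdir' p i k hik, hdir' q j l hjl] at h
    have h' : (Real.pi * Complex.I : ℂ) *
        ((1 + (a i k l + b l i j - a k i j - b j k l) : ℤ) : ℂ) = 0 := by
      push_cast; linear_combination h / 2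
    exact_mod_cast (mul_eq_zero.1 h').resolve_left hpi
  have opp : ∀ i j k l, i < k → l < j →
      a i k l + b l i j - a k i j - b j k l = 0 := fun i j k l hik hjl => by
    have h := hsq i j k l hik.ne hjl.ne'
    rw [ha i k l hik.ne, ha k i j hik.ne', hb l i j hjl.ne, hb j k l hjl.ne',
      hdir' p i k hik, hdir' q l j hjl] at h
    have h' : (Real.pi * Complex.I : ℂ) *
        ((a i k l + b l i j - a k i j - b j k l : ℤ) : ℂ) = 0 := by
      push_cast; linear_combination h / 2
    exact_mod_cast (mul_eq_zero.1 h').resolve_left hpi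
  have l01 : (0 : Fin 3) < 1 := by decide
  have l02 : (0 : Fin 3) < 2 := by decide
  have l12 : (1 : Fin 3) < 2 := by decide
  have s1 := same 0 0 1 1 l01 l01
  have s2 := same 0 0 1 2 l01 l02
  have s3 := same 0 1 1 2 l01 l12
  have s4 := same 0 0 2 1 l02 l01
  have s5 := same 0 0 2 2 l02 l02
  have s6 := same 0 1 2 2 l02 l12
  have s7 := same 1 0 2 1 l12 l01
  have s8 := same 1 0 2 2 l12 l02
  have s9 := same 1 1 2 2 l12 l12
  have o1 := opp 0 1 1 0 l01 l01
  have o2 := opp 0 2 1 0 l01 l02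
  have o3 := opp 0 2 1 1 l01 l12
  have o4 := opp 0 1 2 0 l02 l01
  have o5 := opp 0 2 2 0 l02 l02
  have o6 := opp 0 2 2 1 l02 l12
  have o7 := opp 1 1 2 0 l12 l01
  have o8 := opp 1 2 2 0 l12 l02
  have o9 := opp 1 2 2 1 l12 l12
  -- Parity: each of the integers `a`, `b` belongs to exactly two of the 18 relations, so their sum
  -- reads 9 plus an even number equals 0.
  omega

/-- `K₃,₃` has no drawing by arcs in the plane in which independent edges are disjoint. -/
theorem k33_arcs (p q : Fin 3 → ℝ × ℝ) (A : Fin 3 → Fin 3 → Set (ℝ × ℝ))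
    (hA : ∀ i j, IsArc (p i) (q j) (A i j))
    (hd : ∀ i j k l, i ≠ k → j ≠ l → Disjoint (A i j) (A k l)) : False := by
  choose γ _ hr using hA
  let φ := Complex.equivRealProdCLM.symm
  refine k33_curves (fun i => φ (p i)) (fun j => φ (q j)) (fun i j t => φ ((γ i j).extend t))
    (fun i j => φ.continuous.comp (γ i j).continuous_extend) (fun i j => by simp)
    (fun i j => by simp) (fun i j k l s t hik hjl h => ?_)
  have h := φ.injective h
  have m : ∀ i j t, (γ i j).extend t ∈ A i j := fun i j t => by
    rw [← hr, ← Path.extend_range]; exact ⟨t, rfl⟩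
  exact Set.disjoint_left.1 (hd i j k l hik hjl) (m i j s) (h ▸ m k l t)

/-! ### Exclusion of `K₃,₄` and the degree bound. -/

namespace Drawing

variable {V : Type u} {G : SimpleGraph V}

/-- In a 1-planar drawing, the ends of a crossed edge are neighbours of its false vertex. -/
theorem IsOnePlanar.associated_adj {D : Drawing G} (hD : D.IsOnePlanar) {a b : V}
    (h : G.Adj a b) (c : D.crossings) (hc : (c : ℝ × ℝ) ∈ D.arc ⟨s(a, b), h⟩) :
    D.associated.Adj (Sum.inr c) (Sum.inl a) := by
  obtain ⟨γ, hγ, hr⟩ := D.isArc_arc a b h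
  obtain ⟨t, ht⟩ : ∃ t, γ t = c := by rw [← hr] at hc; exact hc
  have ht0 : t ≠ 0 := fun h0 => c.2.1 ⟨a, by rw [← ht, h0, γ.source]⟩
  have ht1 : t ≠ 1 := fun h1 => c.2.1 ⟨b, by rw [← ht, h1, γ.target]⟩
  -- The part of the arc from the crossing back to `a`. It misses `b` because `t < 1`, and every
  -- other false vertex because the edge is crossed only once.
  let δ : Path (c : ℝ × ℝ) (D.pt a) :=
    { toFun := fun s => γ (t * unitInterval.symm s)
      continuous_toFun := γ.continuous.comp (continuous_const.mul unitInterval.continuous_symm)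
      source' := by simp [ht]
      target' := by simp }
  have hsub : Set.range δ ⊆ D.arc ⟨s(a, b), h⟩ := by
    rw [← hr]; rintro _ ⟨s, rfl⟩; exact ⟨_, rfl⟩
  refine ⟨by simp, ⟨s(a, b), h⟩, Set.range δ, hsub, ⟨δ, fun s s' hs => ?_, rfl⟩, fun z hz => ?_⟩
  · have h1 := congrArg Subtype.val (hγ hs)
    have ht0' : (t : ℝ) ≠ 0 := fun h => ht0 (Subtype.ext h)
    exact unitInterval.symm_bijective.injective (Subtype.ext (mul_left_cancel₀ ht0' h1))
  · rcases z with w | c'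
    · rcases Sym2.mem_iff.1 (D.mem_of_pt_mem_arc _ w (hsub hz)) with rfl | rfl
      · exact Or.inr rfl
      · obtain ⟨s, hs⟩ := hz
        have h1 := congrArg Subtype.val (hγ (hs.trans γ.target.symm))
        refine absurd (Subtype.ext (le_antisymm t.2.2 ?_)) ht1
        have h2 : (t : ℝ) * (unitInterval.symm s : ℝ) = 1 := h1
        have := mul_le_of_le_one_right t.2.1 (unitInterval.symm s).2.2
        change (1 : ℝ) ≤ t
        linarith
    · exact Or.inl (congrArg Sum.inr (Subtype.ext (hD _ ⟨hsub hz, c'.2⟩ ⟨hc, c.2⟩)))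

theorem IsC0.eq_of_adj {D : Drawing G} (hD : D.IsC0) {c c' : D.crossings} {z}
    (h : D.associated.Adj (Sum.inr c) z) (h' : D.associated.Adj (Sum.inr c') z) : c = c' := by
  by_contra hne
  have h0 := Set.encard_eq_zero.1 (hD.2 c c' hne)
  exact (Set.ext_iff.1 h0 z).1 ⟨h, h'⟩

/-- A graph containing `K₃,₄` has no `C₀`-drawing. -/
theorem IsC0.not_k34 {D : Drawing G} (hD : D.IsC0) {L : Fin 3 → V} {R : Fin 4 → V}
    (hL : L.Injective) (hR : R.Injective) (hLR : ∀ i j, G.Adj (L i) (R j)) : False := by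
  let E (i : Fin 3) (j : Fin 4) : G.edgeSet := ⟨s(L i, R j), hLR i j⟩
  have hE : ∀ {i j k l}, E i j = E k l → i = k ∧ j = l := fun {i j k l} h => by
    rcases Sym2.eq_iff.1 (congrArg Subtype.val h) with ⟨h1, h2⟩ | ⟨h1, h2⟩
    · exact ⟨hL h1, hR h2⟩
    · exact absurd h1 (hLR i l).ne
  have hcross : ∀ {i j k l p}, i ≠ k → j ≠ l → p ∈ D.arc (E i j) → p ∈ D.arc (E k l) →
      p ∈ D.crossings := fun {i j k l p} hik hjl h1 h2 => by
    refine ⟨?_, _, _, fun h => hik (hE h).1, h1, h2⟩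
    rintro ⟨w, rfl⟩
    rcases Sym2.mem_iff.1 (D.mem_of_pt_mem_arc _ w h1) with rfl | rfl <;>
      rcases Sym2.mem_iff.1 (D.mem_of_pt_mem_arc _ _ h2) with h | h
    · exact hik (hL h)
    · exact (hLR i l).ne h
    · exact (hLR k j).ne h.symm
    · exact hjl (hR h)
  have key : ∀ f : Fin 3 → Fin 4, f.Injective → ∃ i j k l p, i ≠ k ∧ j ≠ l ∧
      p ∈ D.arc (E i (f j)) ∧ p ∈ D.arc (E k (f l)) := fun f _ => by
    by_contra! hno
    exact k33_arcs (fun i => D.pt (L i)) (fun j => D.pt (R (f j))) (fun i j => D.arc (E i (f j)))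
      (fun i j => D.isArc_arc _ _ (hLR i (f j)))
      (fun i j k l hik hjl => Set.disjoint_left.2 fun p => hno i j k l p hik hjl)
  obtain ⟨i, j, k, l, p, hik, hjl, h1, h2⟩ := key Fin.castSucc (Fin.castSucc_injective 3)
  -- The second `K₃,₃` omits the right vertex `j`, so its edges all differ from the first crossing
  -- edge; a common crossing point would lie on three edges.
  obtain ⟨i', j', k', l', p', hik', hjl', h1', h2'⟩ :=
    key j.castSucc.succAbove Fin.succAbove_right_injective
  have hjl'' := Fin.succAbove_right_injective (p := j.castSucc).ne hjl'
  have hp := hcross hik (by simpa using hjl) h1 h2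
  have hp' := hcross hik' hjl'' h1' h2'
  by_cases hpp : p = p'
  · subst hpp
    exact hp.1 (D.no_triple _ _ _ (fun h => Fin.succAbove_ne _ _ (hE h).2.symm)
      (fun h => Fin.succAbove_ne _ _ (hE h).2.symm) (fun h => hik' (hE h).1) ⟨⟨h1, h1'⟩, h2'⟩)
  · have hne : ∀ {x y}, D.associated.Adj (Sum.inr ⟨p, hp⟩) (Sum.inl (L x)) →
        D.associated.Adj (Sum.inr ⟨p', hp'⟩) (Sum.inl (L y)) → x ≠ y := by
      rintro x _ hx hy rfl
      exact hpp (congrArg Subtype.val (hD.eq_of_adj hx hy))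
    have a1 := hD.1.associated_adj _ ⟨p, hp⟩ h1
    have a2 := hD.1.associated_adj _ ⟨p, hp⟩ h2
    have a3 := hD.1.associated_adj _ ⟨p', hp'⟩ h1'
    have a4 := hD.1.associated_adj _ ⟨p', hp'⟩ h2'
    have b1 := hne a1 a3
    have b2 := hne a1 a4
    have b3 := hne a2 a3
    have b4 := hne a2 a4
    -- Two disjoint pairs of left vertices do not fit into a set of three.
    omega

end Drawing

/-- If the join of `G` with a graph on at least two vertices is of class `C₀`, then `G` has
maximum degree at most three. -/
theorem maxDegree_le_three_of_join {V W : Type*} [Fintype V] (G : SimpleGraph V)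
    [DecidableRel G.Adj] (H : SimpleGraph W) (x y : W) (hxy : x ≠ y) (h : ClassC0 (join G H)) :
    G.maxDegree ≤ 3 := by
  obtain ⟨D, hD⟩ := h
  refine G.maxDegree_le_of_forall_degree_le 3 fun v => ?_
  by_contra! hv
  obtain ⟨f⟩ : Nonempty (Fin 4 ↪ G.neighborFinset v) :=
    Function.Embedding.nonempty_of_card_le (by rwa [Fintype.card_fin, Fintype.card_coe])
  have hf : ∀ j, G.Adj v (f j) := fun j => (G.mem_neighborFinset v _).1 (f j).2
  refine hD.not_k34 (L := ![Sum.inl v, Sum.inr x, Sum.inr y]) (R := fun j => Sum.inl (f j : V))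
    ?_ (fun i j hij => f.injective (Subtype.ext (Sum.inl_injective hij))) ?_
  · intro i j
    fin_cases i <;> fin_cases j <;> simp [hxy, hxy.symm]
  · intro i j
    fin_cases i <;> simp [join, hf]

/-! ### Oriented areas, disjoint segments and proper crossings. -/

/-- Twice the signed area of the triangle `a b c`. -/
def orient {R : Type*} [CommRing R] (a b c : R × R) : R :=
  (b.1 - a.1) * (c.2 - a.2) - (b.2 - a.2) * (c.1 - a.1)

theorem orient_of_mem_segment {a b c d x : ℝ × ℝ} (hx : x ∈ segment ℝ c d) :
    ∃ s t : ℝ, 0 ≤ s ∧ 0 ≤ t ∧ s + t = 1 ∧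
      orient a b x = s * orient a b c + t * orient a b d := by
  obtain ⟨s, t, hs, ht, hst, rfl⟩ := hx
  refine ⟨s, t, hs, ht, hst, ?_⟩
  obtain rfl : s = 1 - t := by linarith
  simp only [orient, Prod.fst_add, Prod.snd_add, Prod.smul_fst, Prod.smul_snd, smul_eq_mul]
  ring

theorem orient_eq_zero_of_mem_segment {a b x : ℝ × ℝ} (hx : x ∈ segment ℝ a b) :
    orient a b x = 0 := by
  obtain ⟨s, t, -, -, -, h⟩ := orient_of_mem_segment (a := a) (b := b) hx
  rw [h]; simp only [orient]; ring

/-- `orient a b` is affine along the segment from `c` to `d`, so with end values of one sign it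
never vanishes there, while it vanishes on the segment from `a` to `b`. -/
theorem disjoint_segment_of_same_side {a b c d : ℝ × ℝ}
    (h : 0 < orient a b c * orient a b d) : Disjoint (segment ℝ a b) (segment ℝ c d) := by
  refine Set.disjoint_left.2 fun x hx hx' => ?_
  obtain ⟨s, t, hs, ht, hst, h'⟩ := orient_of_mem_segment (a := a) (b := b) hx'
  rw [orient_eq_zero_of_mem_segment hx] at h'
  have key : 0 < s * s + t * t := by nlinarith [sq_nonneg (s - t)]
  have h2 : 0 ≤ s * t := mul_nonneg hs ht
  have h3 : (s * orient a b c + t * orient a b d) ^ 2 = 0 := by rw [← h']; ring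
  have h4 : 0 < orient a b c ^ 2 := by
    have : orient a b c ≠ 0 := left_ne_zero_of_mul h.ne'
    positivity
  have h5 : 0 < orient a b d ^ 2 := by
    have : orient a b d ≠ 0 := right_ne_zero_of_mul h.ne'
    positivity
  rcases hs.eq_or_lt with rfl | hs
  · obtain rfl : t = 1 := by linarith
    nlinarith
  · nlinarith [mul_pos (mul_pos hs hs) h4, mul_nonneg (mul_nonneg ht ht) h5.le,
      mul_nonneg h2 h.le]

theorem segment_inter_segment_subset {w a b : ℝ × ℝ} (h : orient w a b ≠ 0) :
    segment ℝ w a ∩ segment ℝ w b ⊆ {w} := by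
  rintro x ⟨hx, s, t, hs, ht, hst, rfl⟩
  have h0 := orient_eq_zero_of_mem_segment hx
  obtain rfl : s = 1 - t := by linarith
  have h1 : t * orient w a b = 0 := by
    rw [← h0]
    simp only [orient, Prod.fst_add, Prod.snd_add, Prod.smul_fst, Prod.smul_snd, smul_eq_mul]
    ring
  obtain rfl : t = 0 := (mul_eq_zero.1 h1).resolve_right h
  simp

theorem isArc_segment {a b : ℝ × ℝ} (h : a ≠ b) : IsArc a b (segment ℝ a b) := by
  refine ⟨⟨⟨fun t => AffineMap.lineMap a b (t : ℝ), by fun_prop⟩, by simp, by simp⟩,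
    fun s t hst => Subtype.ext (AffineMap.lineMap_injective ℝ h hst), ?_⟩
  rw [segment_eq_image_lineMap]
  ext x
  constructor
  · rintro ⟨t, rfl⟩; exact ⟨t, t.2, rfl⟩
  · rintro ⟨t, ht, rfl⟩; exact ⟨⟨t, ht⟩, rfl⟩

/-- The affine coordinates of the plane vanishing on the lines `c d` and `a b`, respectively. -/
noncomputable def lineCoordinates (a b c d : ℝ × ℝ) (h : orient a b c ≠ orient a b d) :
    (ℝ × ℝ) ≃ₜ (ℝ × ℝ) where
  toFun q := (orient c d q, orient a b q)
  invFun z :=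
    (((d.1 - c.1) * (z.2 + (b.1 - a.1) * a.2 - (b.2 - a.2) * a.1) -
      (b.1 - a.1) * (z.1 + (d.1 - c.1) * c.2 - (d.2 - c.2) * c.1)) /
        (orient a b d - orient a b c),
     ((d.2 - c.2) * (z.2 + (b.1 - a.1) * a.2 - (b.2 - a.2) * a.1) -
      (b.2 - a.2) * (z.1 + (d.1 - c.1) * c.2 - (d.2 - c.2) * c.1)) /
        (orient a b d - orient a b c))
  left_inv q := by
    have h' := sub_ne_zero.2 h.symm
    ext
    · rw [div_eq_iff h']; simp only [orient]; ring
    · rw [div_eq_iff h']; simp only [orient]; ring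
  right_inv z := by
    have h' := sub_ne_zero.2 h.symm
    ext
    · refine mul_right_cancel₀ h' ?_
      simp only [orient] at h' ⊢
      field_simp
      ring
    · refine mul_right_cancel₀ h' ?_
      simp only [orient] at h' ⊢
      field_simp
      ring
  continuous_toFun := by unfold orient; fun_prop
  continuous_invFun := by fun_prop

/-- The segments `a b` and `c d` cross properly. -/
def Opposite {R : Type*} [CommRing R] [LinearOrder R] (a b c d : R × R) : Prop :=
  orient a b c * orient a b d < 0 ∧ orient c d a * orient c d b < 0

theorem Opposite.orient_ne {a b c d : ℝ × ℝ} (h : Opposite a b c d) :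
    orient a b c ≠ orient a b d := fun h' => by
  have h1 := h.1
  rw [h'] at h1
  exact absurd h1 (mul_self_nonneg _).not_gt

theorem Opposite.symm {a b c d : ℝ × ℝ} (h : Opposite a b c d) : Opposite c d a b :=
  ⟨h.2, h.1⟩

/-- Near a crossing, a segment is the line through it. -/
theorem Opposite.mem_segment {a b c d q : ℝ × ℝ} (h : Opposite a b c d)
    (hq : (orient c d q - orient c d a) * (orient c d q - orient c d b) < 0)
    (h0 : orient a b q = 0) : q ∈ segment ℝ a b := by
  have hne := h.symm.orient_ne
  have hne' := sub_ne_zero.2 hne.symm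
  set t := (orient c d q - orient c d a) / (orient c d b - orient c d a) with ht
  have hqt : orient c d q = orient c d a + t * (orient c d b - orient c d a) := by
    rw [ht, div_mul_cancel₀ _ hne']; ring
  have hpos : 0 < (orient c d b - orient c d a) ^ 2 := by positivity
  have ht' : t * (1 - t) > 0 := by
    rw [hqt] at hq
    by_contra! hcon
    nlinarith
  have ht0 : 0 < t := by by_contra! h; nlinarith
  have ht1 : 0 < 1 - t := by by_contra! h; nlinarith
  refine ⟨1 - t, t, ht1.le, ht0.le, by ring, ?_⟩
  refine (lineCoordinates a b c d h.orient_ne).injective (Prod.ext ?_ ?_)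
  · change orient c d _ = orient c d q
    rw [hqt]
    simp only [orient, Prod.fst_add, Prod.snd_add, Prod.smul_fst, Prod.smul_snd, smul_eq_mul]
    ring
  · change orient a b _ = orient a b q
    rw [h0]
    simp only [orient, Prod.fst_add, Prod.snd_add, Prod.smul_fst, Prod.smul_snd, smul_eq_mul]
    ring

theorem Opposite.subsingleton_inter {a b c d : ℝ × ℝ} (h : Opposite a b c d) :
    (segment ℝ a b ∩ segment ℝ c d).Subsingleton := fun _ hp _ hq =>
  (lineCoordinates a b c d h.orient_ne).injective (Prod.ext
    ((orient_eq_zero_of_mem_segment hp.2).trans (orient_eq_zero_of_mem_segment hq.2).symm)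
    ((orient_eq_zero_of_mem_segment hp.1).trans (orient_eq_zero_of_mem_segment hq.1).symm))

theorem Opposite.crossAt {a b c d p : ℝ × ℝ} (h : Opposite a b c d) (hp : p ∈ segment ℝ a b)
    (hp' : p ∈ segment ℝ c d) : CrossAt (segment ℝ a b) (segment ℝ c d) p := by
  have h1 := orient_eq_zero_of_mem_segment hp
  have h2 := orient_eq_zero_of_mem_segment hp'
  -- The parallelogram bounded by the parallels to each line through the end points of the other
  -- segment; inside it both segments coincide with their lines.
  let U : Set (ℝ × ℝ) := {q | (orient c d q - orient c d a) * (orient c d q - orient c d b) < 0} ∩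
    {q | (orient a b q - orient a b c) * (orient a b q - orient a b d) < 0}
  have hU : IsOpen U := by
    refine (isOpen_lt ?_ continuous_const).inter (isOpen_lt ?_ continuous_const) <;>
      (unfold orient; fun_prop)
  refine ⟨(lineCoordinates a b c d h.orient_ne).toOpenPartialHomeomorph.restrOpen U hU,
    ?_, fun q hq => ?_⟩
  · simpa [U, h1, h2] using And.intro h.2 h.1
  · have hq' : q ∈ U := by simpa using hq
    change (_ ↔ orient a b q = orient a b p) ∧ (_ ↔ orient c d q = orient c d p)
    rw [h1, h2]
    exact ⟨⟨orient_eq_zero_of_mem_segment, h.mem_segment hq'.1⟩,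
      ⟨orient_eq_zero_of_mem_segment, h.symm.mem_segment hq'.2⟩⟩

/-! ### From finite orientation data to a `C₀`-drawing. -/

section StraightLine

variable {V : Type u}

/-- The straight line segment drawn for an unordered pair of vertices. -/
def segmentOf (P : V → ℝ × ℝ) : Sym2 V → Set (ℝ × ℝ) :=
  Sym2.lift ⟨fun u v => segment ℝ (P u) (P v), fun _ _ => segment_symm _ _ _⟩

/-- Data certifying that the straight line drawing of `G` on the points `P` is a `C₀`-drawing with
(at most) two crossings: `X i b` is the edge `b` of the crossing `i`. -/
structure StraightC0 (G : SimpleGraph V) (P : V → ℝ × ℝ) (X : Bool × Bool × Bool → V) : Prop where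
  injective : P.Injective
  injective_crossing : X.Injective
  orient_ne_zero : ∀ u v w, u ≠ v → u ≠ w → v ≠ w → orient (P u) (P v) (P w) ≠ 0
  opposite : ∀ i, Opposite (P (X (i, false, false))) (P (X (i, false, true)))
    (P (X (i, true, false))) (P (X (i, true, true)))
  disjoint_or : ∀ u v w z, G.Adj u v → G.Adj w z → u ≠ w → u ≠ z → v ≠ w → v ≠ z →
    Disjoint (segment ℝ (P u) (P v)) (segment ℝ (P w) (P z)) ∨
      ∃ i b, s(u, v) = s(X (i, b, false), X (i, b, true)) ∧
        s(w, z) = s(X (i, !b, false), X (i, !b, true))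

namespace StraightC0

variable {G : SimpleGraph V} {P : V → ℝ × ℝ} {X : Bool × Bool × Bool → V}

theorem opposite' (h : StraightC0 G P X) (i b : Bool) :
    Opposite (P (X (i, b, false))) (P (X (i, b, true)))
      (P (X (i, !b, false))) (P (X (i, !b, true))) := by
  cases b
  · exact h.opposite i
  · exact (h.opposite i).symm

theorem mem_of_pt_mem (h : StraightC0 G P X) {e : Sym2 V} (he : e ∈ G.edgeSet) {w : V}
    (hw : P w ∈ segmentOf P e) : w ∈ e := by
  induction e with
  | h u v =>
    by_contra hcon
    rw [Sym2.mem_iff, not_or] at hcon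
    exact h.orient_ne_zero u v w (G.ne_of_adj he) (Ne.symm hcon.1) (Ne.symm hcon.2)
      (orient_eq_zero_of_mem_segment hw)

theorem adjacent_inter (h : StraightC0 G P X) {e f : Sym2 V} (he : e ∈ G.edgeSet)
    (hf : f ∈ G.edgeSet) (hne : e ≠ f) {w : V} (hwe : w ∈ e) (hwf : w ∈ f) :
    segmentOf P e ∩ segmentOf P f ⊆ {P w} := by
  obtain ⟨a, rfl⟩ := hwe
  obtain ⟨b, rfl⟩ := hwf
  exact segment_inter_segment_subset (h.orient_ne_zero w a b (G.ne_of_adj he) (G.ne_of_adj hf)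
    fun hab => hne (by rw [hab]))

theorem exists_crossing (h : StraightC0 G P X) {e f : Sym2 V} (he : e ∈ G.edgeSet)
    (hf : f ∈ G.edgeSet) (hne : e ≠ f) {p : ℝ × ℝ} (hp : p ∈ segmentOf P e)
    (hp' : p ∈ segmentOf P f) (hp0 : p ∉ Set.range P) :
    ∃ i b, e = s(X (i, b, false), X (i, b, true)) ∧
      f = s(X (i, !b, false), X (i, !b, true)) := by
  have hind : ∀ w, w ∈ e → w ∉ f := fun w hwe hwf =>
    hp0 ⟨w, (h.adjacent_inter he hf hne hwe hwf ⟨hp, hp'⟩).symm⟩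
  induction e with
  | h u v =>
    induction f with
    | h w z =>
      have hu := hind u (Sym2.mem_mk_left u v)
      have hv := hind v (Sym2.mem_mk_right u v)
      rw [Sym2.mem_iff, not_or] at hu hv
      exact (h.disjoint_or u v w z he hf hu.1 hu.2 hv.1 hv.2).resolve_left
        fun hd => Set.disjoint_left.1 hd hp hp'

/-- Injectivity of `X` makes the eight end vertices distinct, so a single end vertex determines the
crossing and the edge. -/
theorem crossing_inj (h : StraightC0 G P X) {i b i' b' : Bool} {w : V}
    (hw : w ∈ s(X (i, b, false), X (i, b, true)))
    (hw' : w ∈ s(X (i', b', false), X (i', b', true))) : i = i' ∧ b = b' := by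
  rw [Sym2.mem_iff] at hw hw'
  rcases hw with rfl | rfl <;> rcases hw' with hw' | hw' <;>
    simpa using h.injective_crossing hw'

theorem eq_of_crossing (h : StraightC0 G P X) {e f g : Sym2 V}
    (hef : ∃ i b, e = s(X (i, b, false), X (i, b, true)) ∧
      f = s(X (i, !b, false), X (i, !b, true)))
    (heg : ∃ i b, e = s(X (i, b, false), X (i, b, true)) ∧
      g = s(X (i, !b, false), X (i, !b, true))) : f = g := by
  obtain ⟨i, b, rfl, rfl⟩ := hef
  obtain ⟨i', b', he, rfl⟩ := heg
  obtain ⟨rfl, rfl⟩ := h.crossing_inj (Sym2.mem_mk_left _ _) (he ▸ Sym2.mem_mk_left _ _)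
  rfl

theorem subsingleton_inter (h : StraightC0 G P X) {e f : Sym2 V} (he : e ∈ G.edgeSet)
    (hf : f ∈ G.edgeSet) (hne : e ≠ f) : (segmentOf P e ∩ segmentOf P f).Subsingleton := by
  by_cases hc : ∃ w, w ∈ e ∧ w ∈ f
  · obtain ⟨w, hwe, hwf⟩ := hc
    exact Set.subsingleton_singleton.anti (h.adjacent_inter he hf hne hwe hwf)
  · rintro p hp q hq
    have hp0 : p ∉ Set.range P := by
      rintro ⟨w, rfl⟩
      exact hc ⟨w, h.mem_of_pt_mem he hp.1, h.mem_of_pt_mem hf hp.2⟩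
    obtain ⟨i, b, rfl, rfl⟩ := h.exists_crossing he hf hne hp.1 hp.2 hp0
    exact (h.opposite' i b).subsingleton_inter hp hq

/-- The straight line drawing. -/
def drawing (h : StraightC0 G P X) : Drawing G where
  pt := P
  arc e := segmentOf P e
  pt_injective := h.injective
  isArc_arc a b hab := isArc_segment (h.injective.ne (G.ne_of_adj hab))
  mem_of_pt_mem_arc e w hw := h.mem_of_pt_mem e.2 hw
  adjacent_inter e f w hne hwe hwf :=
    h.adjacent_inter e.2 f.2 (fun h' => hne (Subtype.ext h')) hwe hwf
  finite_inter e f hne :=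
    (h.subsingleton_inter e.2 f.2 (fun h' => hne (Subtype.ext h'))).finite
  crossAt e f p hne hp hp' hp0 := by
    obtain ⟨i, b, he, hf⟩ := h.exists_crossing e.2 f.2 (fun h' => hne (Subtype.ext h')) hp hp' hp0
    rw [he] at hp ⊢
    rw [hf] at hp' ⊢
    exact (h.opposite' i b).crossAt hp hp'
  no_triple e f g hef heg hfg := by
    rintro p ⟨⟨hpe, hpf⟩, hpg⟩
    by_contra hp0
    exact hfg (Subtype.ext (h.eq_of_crossing
      (h.exists_crossing e.2 f.2 (fun h' => hef (Subtype.ext h')) hpe hpf hp0)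
      (h.exists_crossing e.2 g.2 (fun h' => heg (Subtype.ext h')) hpe hpg hp0)))

theorem exists_of_mem_crossings (h : StraightC0 G P X) {e : G.edgeSet} {p : ℝ × ℝ}
    (hp : p ∈ h.drawing.arc e) (hp' : p ∈ h.drawing.crossings) :
    ∃ f : G.edgeSet, e ≠ f ∧ p ∈ h.drawing.arc f ∧
      ∃ i b, (e : Sym2 V) = s(X (i, b, false), X (i, b, true)) ∧
      (f : Sym2 V) = s(X (i, !b, false), X (i, !b, true)) := by
  obtain ⟨hp0, f, g, hfg, hf, hg⟩ := hp'
  obtain ⟨f', hef, hf'⟩ : ∃ f' : G.edgeSet, e ≠ f' ∧ p ∈ h.drawing.arc f' := by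
    by_cases hef : e = f
    · exact ⟨g, hef ▸ hfg, hg⟩
    · exact ⟨f, hef, hf⟩
  exact ⟨f', hef, hf', h.exists_crossing e.2 f'.2 (fun h' => hef (Subtype.ext h')) hp hf' hp0⟩

theorem isOnePlanar (h : StraightC0 G P X) : h.drawing.IsOnePlanar := by
  rintro e p ⟨hp, hpc⟩ q ⟨hq, hqc⟩
  obtain ⟨f, hef, hf, hX⟩ := h.exists_of_mem_crossings hp hpc
  obtain ⟨g, heg, hg, hX'⟩ := h.exists_of_mem_crossings hq hqc
  obtain rfl := Subtype.ext (h.eq_of_crossing hX hX')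
  exact h.subsingleton_inter e.2 f.2 (fun h' => hef (Subtype.ext h')) ⟨hp, hf⟩ ⟨hq, hg⟩

theorem exists_edge_of_adj (h : StraightC0 G P X) {c : h.drawing.crossings}
    {z : V ⊕ h.drawing.crossings} (hz : h.drawing.associated.Adj (Sum.inr c) z) :
    ∃ (e : G.edgeSet) (w : V), z = Sum.inl w ∧ (c : ℝ × ℝ) ∈ h.drawing.arc e ∧
      w ∈ (e : Sym2 V) := by
  obtain ⟨hne, e, A, hA, ⟨γ, -, hγ⟩, -⟩ := hz
  have hc : (c : ℝ × ℝ) ∈ h.drawing.arc e := hA (hγ ▸ ⟨0, γ.source⟩)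
  have hz : h.drawing.pos z ∈ h.drawing.arc e := hA (hγ ▸ ⟨1, γ.target⟩)
  rcases z with w | c'
  · exact ⟨e, w, rfl, hc, h.drawing.mem_of_pt_mem_arc e w hz⟩
  · exact absurd (congrArg Sum.inr (Subtype.ext (h.isOnePlanar e ⟨hc, c.2⟩ ⟨hz, c'.2⟩))) hne

/-- A common neighbour of two false vertices is an end of a crossed edge through each. By
`crossing_inj` these edges coincide, and an edge carries only one crossing. -/
theorem classC0 (h : StraightC0 G P X) : ClassC0 G := by
  refine ⟨h.drawing, h.isOnePlanar, fun c c' hne => Set.encard_eq_zero.2 ?_⟩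
  refine Set.eq_empty_of_forall_notMem fun z hz => hne (Subtype.ext ?_)
  obtain ⟨e, w, rfl, hc, hw⟩ := h.exists_edge_of_adj hz.1
  obtain ⟨e', w', hww, hc', hw'⟩ := h.exists_edge_of_adj hz.2
  obtain rfl := Sum.inl_injective hww
  obtain ⟨-, -, -, i, b, he, -⟩ := h.exists_of_mem_crossings hc c.2
  obtain ⟨-, -, -, i', b', he', -⟩ := h.exists_of_mem_crossings hc' c'.2
  obtain ⟨rfl, rfl⟩ := h.crossing_inj (he ▸ hw) (he' ▸ hw')
  obtain rfl : e = e' := Subtype.ext (he.trans he'.symm)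
  exact h.isOnePlanar e ⟨hc, c.2⟩ ⟨hc', c'.2⟩

end StraightC0

end StraightLine

/-! ### Coordinates of the rim and the hubs, and their orientations. -/

theorem orient_rotate {R : Type*} [CommRing R] (a b c : R × R) : orient b c a = orient a b c := by
  simp only [orient]; ring

theorem orient_swap {R : Type*} [CommRing R] (a b c : R × R) : orient b a c = -orient a b c := by
  simp only [orient]; ring

theorem orient_swap_right {R : Type*} [CommRing R] (a b c : R × R) :
    orient a c b = -orient a b c := by
  simp only [orient]; ring

/-- The position of the rim vertex `i`: on a parabola, except for the vertex `4`. -/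
def rimPoint (i : ℕ) : ℤ × ℤ :=
  -- At abscissa 3 the parabola has height -9 and the chord `3 5` height -13; at height -14 the
  -- vertex 4 drops below this chord but stays above every other chord from a smaller to a larger
  -- index.
  if i = 4 then (3, -14) else (2 * (i : ℤ) - 5, -(2 * (i : ℤ) - 5) ^ 2)

/-- The position of the upper (`true`) and of the lower (`false`) hub. -/
def hubPoint (k : ℕ) (b : Bool) : ℤ × ℤ :=
  -- The line through rim points of the parabola with abscissas `u`, `v` meets the axis at height `u
  -- * v`. For the long edge this is `35 - 10 * k`, one below the lower hub; the largest value, at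
  -- most `(2 * k - 7) * (2 * k - 9)`, is below `4 * k ^ 2`.
  (0, if b then 4 * k ^ 2 else 36 - 10 * k)

theorem rimPoint_four : rimPoint 4 = (3, -14) := rfl

theorem rimPoint_of_ne {i : ℕ} (h : i ≠ 4) :
    rimPoint i = (2 * (i : ℤ) - 5, -(2 * (i : ℤ) - 5) ^ 2) :=
  if_neg h

theorem orient_rim_of_ne {a b c : ℕ} (ha : a ≠ 4) (hb : b ≠ 4) (hc : c ≠ 4) :
    orient (rimPoint a) (rimPoint b) (rimPoint c) =
      8 * ((b - a : ℤ) * ((c - a) * (b - c))) := by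
  rw [rimPoint_of_ne ha, rimPoint_of_ne hb, rimPoint_of_ne hc]; simp only [orient]; ring

/-- The summand 5 is the distance by which vertex 4 is lowered from the parabola. -/
theorem orient_rim_four {a b : ℕ} (ha : a ≠ 4) (hb : b ≠ 4) :
    orient (rimPoint a) (rimPoint b) (rimPoint 4) =
      -(2 * ((b - a : ℤ) * (4 * ((a - 4) * (b - 4)) + 5))) := by
  rw [rimPoint_of_ne ha, rimPoint_of_ne hb, rimPoint_four]; simp only [orient]; ring

theorem orient_rim_hub {a b k : ℕ} (ha : a ≠ 4) (hb : b ≠ 4) (t : Bool) :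
    orient (rimPoint a) (rimPoint b) (hubPoint k t) =
      2 * ((b - a : ℤ) * ((hubPoint k t).2 - (2 * a - 5) * (2 * b - 5))) := by
  rw [rimPoint_of_ne ha, rimPoint_of_ne hb]; simp only [orient, hubPoint]; ring

/-- By concavity the parabola lies below a chord's line outside the chord, and lowering vertex 4
preserves this. Chords ending at 4 are excluded. -/
theorem orient_rim_neg {a b c : ℕ} (hab : a < b) (ha : a ≠ 4) (hb : b ≠ 4)
    (hc : c < a ∨ b < c) : orient (rimPoint a) (rimPoint b) (rimPoint c) < 0 := by
  have h1 : (0 : ℤ) < b - a := by omega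
  by_cases h4 : c = 4
  · subst h4
    rw [orient_rim_four ha hb]
    have h2 : (0 : ℤ) ≤ (a - 4) * (b - 4) := by
      rcases hc with h | h
      · exact mul_nonneg (by omega) (by omega)
      · exact mul_nonneg_of_nonpos_of_nonpos (by omega) (by omega)
    have := mul_pos h1 (show (0 : ℤ) < 4 * ((a - 4) * (b - 4)) + 5 by linarith)
    linarith
  · rw [orient_rim_of_ne ha hb h4]
    have h2 : (c - a : ℤ) * (b - c) < 0 := by
      rcases hc with h | h
      · exact mul_neg_of_neg_of_pos (by omega) (by omega)
      · exact mul_neg_of_pos_of_neg (by omega) (by omega)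
    have := mul_neg_of_pos_of_neg h1 h2
    linarith

theorem orient_rim_ne_zero_of_lt {a b c : ℕ} (hab : a < b) (hbc : b < c) :
    orient (rimPoint a) (rimPoint b) (rimPoint c) ≠ 0 := by
  by_cases hb : b = 4
  · subst hb
    have hc : c ≠ 4 := by omega
    rw [orient_swap_right, orient_rim_four (by omega) hc, neg_neg]
    have h1 : (c - a : ℤ) ≠ 0 := by omega
    -- The number is odd.
    have h2 : (4 * ((a - 4) * (c - 4)) + 5 : ℤ) ≠ 0 := by omega
    exact mul_ne_zero two_ne_zero (mul_ne_zero h1 h2)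
  · by_cases ha : a = 4
    · rw [← orient_rotate]
      exact (orient_rim_neg hbc hb (by omega) (Or.inl hab)).ne
    · exact (orient_rim_neg hab ha hb (Or.inr hbc)).ne

theorem orient_rim_ne_zero {a b c : ℕ} (hab : a ≠ b) (hac : a ≠ c) (hbc : b ≠ c) :
    orient (rimPoint a) (rimPoint b) (rimPoint c) ≠ 0 := by
  rcases hab.lt_or_gt with h1 | h1 <;> rcases hac.lt_or_gt with h2 | h2 <;>
    rcases hbc.lt_or_gt with h3 | h3
  · exact orient_rim_ne_zero_of_lt h1 h3
  · rw [orient_swap_right]; exact neg_ne_zero.2 (orient_rim_ne_zero_of_lt h2 h3)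
  · omega
  · rw [← orient_rotate, ← orient_rotate]; exact orient_rim_ne_zero_of_lt h2 h1
  · rw [orient_swap]; exact neg_ne_zero.2 (orient_rim_ne_zero_of_lt h1 h2)
  · omega
  · rw [← orient_rotate]; exact orient_rim_ne_zero_of_lt h3 h2
  · rw [orient_swap, ← orient_rotate, ← orient_rotate]
    exact neg_ne_zero.2 (orient_rim_ne_zero_of_lt h3 h1)

section Hubs

variable {k : ℕ} (hk : 6 ≤ k)
include hk

/-- The lower hub is below all lines through two rim vertices but one. -/
theorem orient_rim_lower {a b : ℕ} (hab : a < b) (hbk : b < k) (h : ¬(a = 0 ∧ b + 1 = k)) :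
    orient (rimPoint a) (rimPoint b) (hubPoint k false) < 0 := by
  by_cases ha : a = 4
  · subst ha
    rw [rimPoint_four, rimPoint_of_ne (i := b) (by omega)]
    simp only [orient, hubPoint]
    obtain ⟨c, rfl⟩ : ∃ c, b = c + 5 := ⟨b - 5, by omega⟩
    obtain ⟨m, rfl⟩ : ∃ m, k = m + 6 := ⟨k - 6, by omega⟩
    push_cast
    have : (0 : ℤ) ≤ c * m := by positivity
    have : (0 : ℤ) ≤ c * c := by positivity
    nlinarith
  · by_cases hb : b = 4
    · subst hb
      rw [rimPoint_four, rimPoint_of_ne ha]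
      simp only [orient, hubPoint]
      have : (6 : ℤ) ≤ k := by omega
      interval_cases a <;> norm_num <;> omega
    · rw [orient_rim_hub ha hb]
      have h1 : (0 : ℤ) < b - a := by omega
      have h2 : (hubPoint k false).2 - (2 * a - 5) * (2 * b - 5) < (0 : ℤ) := by
        simp only [hubPoint, Bool.false_eq_true, if_false]
        rcases Nat.lt_or_ge a 3 with h3 | h3
        · interval_cases a <;> push_cast <;> omega
        · have : (0 : ℤ) ≤ (2 * a - 5) * (2 * b - 5) := mul_nonneg (by omega) (by omega)
          omega
      have := mul_neg_of_pos_of_neg h1 h2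
      linarith

/-- The upper hub is above all lines through two rim vertices. -/
theorem orient_rim_upper {a b : ℕ} (hab : a < b) (hbk : b < k) :
    0 < orient (rimPoint a) (rimPoint b) (hubPoint k true) := by
  have hk2 : (k : ℤ) * 6 ≤ k ^ 2 := by nlinarith
  by_cases ha : a = 4
  · subst ha
    rw [rimPoint_four, rimPoint_of_ne (i := b) (by omega)]
    simp only [orient, hubPoint]
    obtain ⟨c, rfl⟩ : ∃ c, b = c + 5 := ⟨b - 5, by omega⟩
    obtain ⟨m, rfl⟩ : ∃ m, k = c + 6 + m := ⟨k - (c + 6), by omega⟩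
    push_cast
    have h1 : (0 : ℤ) ≤ c := by positivity
    have h2 : (0 : ℤ) ≤ m := by positivity
    have : 0 ≤ (c : ℤ) * m := by positivity
    have : 0 ≤ (c : ℤ) * c := by positivity
    have : 0 ≤ (c : ℤ) * c * c := by positivity
    have : 0 ≤ (c : ℤ) * c * m := by positivity
    have : 0 ≤ (c : ℤ) * m * m := by positivity
    have : 0 ≤ (m : ℤ) * m := by positivity
    ring_nf
    nlinarith
  · by_cases hb : b = 4
    · subst hb
      rw [rimPoint_four, rimPoint_of_ne ha]
      simp only [orient, hubPoint]
      have : (6 : ℤ) ≤ k := by omega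
      interval_cases a <;> norm_num <;> linarith
    · rw [orient_rim_hub ha hb]
      have h1 : (0 : ℤ) < b - a := by omega
      have h2 : 0 < (hubPoint k true).2 - (2 * a - 5) * (2 * b - 5 : ℤ) := by
        simp only [hubPoint, if_true]
        rcases Nat.lt_or_ge a 3 with h3 | h3
        · have : (b : ℤ) < k := by omega
          interval_cases a <;> push_cast <;> linarith
        · have : ((2 * a - 5) * (2 * b - 5) : ℤ) ≤ (2 * k) * (2 * k - 5) :=
            mul_le_mul (by omega) (by omega) (by omega) (by omega)
          nlinarith
      have := mul_pos h1 h2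
      linarith

theorem orient_longEdge_rim {a n : ℕ} (h0 : 0 < a) (han : a < n) (hn : n + 1 = k) :
    0 < orient (rimPoint 0) (rimPoint n) (rimPoint a) := by
  by_cases ha : a = 4
  · subst ha
    rw [orient_rim_four (by omega) (by omega)]
    push_cast
    nlinarith
  · rw [orient_rim_of_ne (by omega) (by omega) ha]
    have := mul_pos (show (0 : ℤ) < n - (0 : ℕ) by omega)
      (mul_pos (show (0 : ℤ) < a - (0 : ℕ) by omega) (show (0 : ℤ) < n - a by omega))
    linarith

theorem orient_longEdge_lower {n : ℕ} (hn : n + 1 = k) :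
    0 < orient (rimPoint 0) (rimPoint n) (hubPoint k false) := by
  rw [orient_rim_hub (by omega) (by omega)]
  subst hn
  simp only [hubPoint, Bool.false_eq_true, if_false]
  push_cast
  have : (5 : ℤ) ≤ n := by omega
  linarith

/-- The hubs lie on the axis of abscissa 0, and the rim abscissas `2 * a - 5` are odd and change
sign between the indices 2 and 3. -/
theorem orient_hubs_left {a : ℕ} (ha : a ≤ 2) :
    0 < orient (hubPoint k false) (hubPoint k true) (rimPoint a) := by
  rw [rimPoint_of_ne (i := a) (by omega)]
  simp only [orient, hubPoint, Bool.false_eq_true, if_false, if_true]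
  have : (0 : ℤ) < (4 * k ^ 2 - (36 - 10 * k)) * (5 - 2 * a) := mul_pos (by nlinarith) (by omega)
  linarith

theorem orient_hubs_right {a : ℕ} (ha : 3 ≤ a) :
    orient (hubPoint k false) (hubPoint k true) (rimPoint a) < 0 := by
  have h0 : (0 : ℤ) < 4 * k ^ 2 - (36 - 10 * k) := by nlinarith
  simp only [orient, hubPoint, Bool.false_eq_true, if_false, if_true, rimPoint]
  split_ifs with h
  · linarith
  · have : (0 : ℤ) < (4 * k ^ 2 - (36 - 10 * k)) * (2 * a - 5) := mul_pos h0 (by omega)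
    linarith

end Hubs

/-! ### Separation of the pairs of edges that do not cross. -/

/-- One of the segments `a b` and `c d` lies strictly on one side of the line of the other. -/
def Separated {R : Type*} [CommRing R] [LinearOrder R] (a b c d : R × R) : Prop :=
  0 < orient a b c * orient a b d ∨ 0 < orient c d a * orient c d b

section Separated

variable {R : Type*} [CommRing R] [LinearOrder R] {a b c d : R × R}

theorem Separated.symm (h : Separated a b c d) : Separated c d a b := Or.symm h

theorem Separated.swap (h : Separated a b c d) : Separated b a c d := by
  rcases h with h | h
  · left; rwa [orient_swap a b c, orient_swap a b d, neg_mul_neg]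
  · right; rwa [mul_comm]

variable [IsStrictOrderedRing R]

theorem separated_of_pos (h1 : 0 < orient a b c) (h2 : 0 < orient a b d) : Separated a b c d :=
  Or.inl (mul_pos h1 h2)

theorem separated_of_neg (h1 : orient a b c < 0) (h2 : orient a b d < 0) : Separated a b c d :=
  Or.inl (mul_pos_of_neg_of_neg h1 h2)

end Separated

/-- The pairs `i < j` of adjacent rim vertices. -/
def RimEdge (k i j : ℕ) : Prop :=
  i < j ∧ j < k ∧ (j = i + 1 ∨ (i = 0 ∧ j + 1 = k) ∨ (i = 0 ∧ j = 2) ∨ (i = 3 ∧ j = 5))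

section

variable {k : ℕ} (hk : 6 ≤ k)
include hk

theorem separated_rim_rim {i j m n : ℕ} (h : RimEdge k i j) (h' : RimEdge k m n)
    (him : i ≠ m) (hin : i ≠ n) (hjm : j ≠ m) (hjn : j ≠ n) :
    Separated (rimPoint i) (rimPoint j) (rimPoint m) (rimPoint n) := by
  wlog hlt : i < m generalizing i j m n
  · exact (this h' h him.symm hjm.symm hin.symm hjn.symm (by omega)).symm
  obtain ⟨h1, h2, h3⟩ := h
  obtain ⟨h1', h2', h3'⟩ := h'
  by_cases hlong : i = 0 ∧ j + 1 = k
  · obtain ⟨rfl, hj⟩ := hlong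
    exact separated_of_pos (orient_longEdge_rim hk hlt (by omega) hj)
      (orient_longEdge_rim hk (by omega) (by omega) hj)
  -- Apart from the long edge, disjoint rim edges span disjoint index intervals, even for the
  -- chords: an edge inside one would share an end with it.
  have hjm' : j < m := by omega
  -- The line used must not pass through vertex 4, where concavity fails; at most one of the two
  -- edges contains it.
  by_cases h4 : i = 4 ∨ j = 4
  · exact (separated_of_neg (orient_rim_neg h1' (by omega) (by omega) (Or.inl (by omega)))
      (orient_rim_neg h1' (by omega) (by omega) (Or.inl (by omega)))).symm
  · exact separated_of_neg (orient_rim_neg h1 (by omega) (by omega) (Or.inr (by omega)))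
      (orient_rim_neg h1 (by omega) (by omega) (Or.inr (by omega)))

/-- The rim is seen from the lower hub in index order, so generally the line of the spoke leaves the
rim edge on one side. The index pair `0`, `k - 1`, where this order breaks, and the chord `3 5` are
treated by the line of the rim edge. -/
theorem separated_lower_rim {i a b : ℕ} (hi : i < k) (h : RimEdge k a b) (hia : i ≠ a)
    (hib : i ≠ b) (hX : ¬(i = 1 ∧ a = 0 ∧ b = 2)) :
    Separated (hubPoint k false) (rimPoint i) (rimPoint a) (rimPoint b) := by
  obtain ⟨h1, h2, h3⟩ := h
  by_cases hlong : a = 0 ∧ b + 1 = k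
  · obtain ⟨rfl, hb⟩ := hlong
    exact (separated_of_pos (orient_longEdge_lower hk hb)
      (orient_longEdge_rim hk (by omega) (by omega) hb)).symm
  have hab := orient_rim_lower hk h1 h2 hlong
  by_cases h4 : a = 3 ∧ b = 5
  · obtain ⟨rfl, rfl⟩ := h4
    refine (separated_of_neg hab ?_).symm
    rcases lt_trichotomy i 4 with h | rfl | h
    · exact orient_rim_neg h1 (by omega) (by omega) (by omega)
    · rw [orient_rim_four (by omega) (by omega)]; norm_num
    · exact orient_rim_neg h1 (by omega) (by omega) (by omega)
  by_cases hi0 : i = 0 ∧ b + 1 = k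
  · obtain ⟨rfl, hb⟩ := hi0
    refine (separated_of_neg hab ?_).symm
    by_cases ha : a = 4
    · subst ha
      obtain rfl : b = 5 := by omega
      simp [orient, rimPoint]
    · exact orient_rim_neg h1 ha (by omega) (Or.inl (by omega))
  by_cases hik : i + 1 = k ∧ a = 0
  · obtain ⟨hik, rfl⟩ := hik
    exact (separated_of_neg hab
      (orient_rim_neg h1 (by omega) (by omega) (Or.inr (by omega)))).symm
  rcases lt_or_ge i a with hlt | hge
  · refine separated_of_neg ?_ ?_
    · rw [← orient_rotate]; exact orient_rim_lower hk hlt (by omega) (by omega)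
    · rw [← orient_rotate]; exact orient_rim_lower hk (by omega) h2 (by omega)
  · refine separated_of_pos ?_ ?_
    · rw [orient_swap_right, ← orient_rotate, neg_pos]
      exact orient_rim_lower hk (by omega) hi (by omega)
    · rw [orient_swap_right, ← orient_rotate, neg_pos]
      exact orient_rim_lower hk (by omega) hi (by omega)

theorem separated_upper_rim {i a b : ℕ} (hi : i < k) (h : RimEdge k a b) (hia : i ≠ a)
    (hib : i ≠ b) (hX : ¬(i = 4 ∧ a = 3 ∧ b = 5)) :
    Separated (hubPoint k true) (rimPoint i) (rimPoint a) (rimPoint b) := by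
  obtain ⟨h1, h2, h3⟩ := h
  have hab := orient_rim_upper hk h1 h2
  by_cases hlong : a = 0 ∧ b + 1 = k
  · obtain ⟨rfl, hb⟩ := hlong
    exact (separated_of_pos hab (orient_longEdge_rim hk (by omega) (by omega) hb)).symm
  by_cases h02 : i = 1 ∧ a = 0 ∧ b = 2
  · obtain ⟨rfl, rfl, rfl⟩ := h02
    refine (separated_of_pos hab ?_).symm
    simp [orient, rimPoint]
  rcases lt_or_ge i a with hlt | hge
  · refine separated_of_pos ?_ ?_
    · rw [← orient_rotate]; exact orient_rim_upper hk hlt (by omega)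
    · rw [← orient_rotate]; exact orient_rim_upper hk (by omega) h2
  · refine separated_of_neg ?_ ?_
    · rw [orient_swap_right, ← orient_rotate, neg_neg_iff_pos]
      exact orient_rim_upper hk (by omega) hi
    · rw [orient_swap_right, ← orient_rotate, neg_neg_iff_pos]
      exact orient_rim_upper hk (by omega) hi

/-- The line of one of the two spokes always works. The side of the hub axis containing `j` and the
order of `i` and `j` decide which, so that the exceptional pair `0`, `k - 1` is never used with the
lower hub. -/
theorem separated_lower_upper {i j : ℕ} (hi : i < k) (hj : j < k) (hij : i ≠ j) :
    Separated (hubPoint k false) (rimPoint i) (hubPoint k true) (rimPoint j) := by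
  rcases lt_or_ge j 3 with hj3 | hj3
  · have h1 := orient_hubs_left hk (a := j) (by omega)
    rcases hij.lt_or_gt with hlt | hlt
    · refine separated_of_neg ?_ ?_
      · rw [orient_swap_right, neg_neg_iff_pos]; exact orient_hubs_left hk (by omega)
      · rw [← orient_rotate]; exact orient_rim_lower hk hlt hj (by omega)
    · refine (separated_of_pos ?_ ?_).symm
      · rwa [orient_rotate]
      · rw [← orient_rotate]; exact orient_rim_upper hk hlt hi
  · have h1 := orient_hubs_right hk hj3
    rcases hij.lt_or_gt with hlt | hlt
    · refine (separated_of_neg ?_ ?_).symm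
      · rwa [orient_rotate]
      · rw [orient_swap_right, ← orient_rotate, neg_neg_iff_pos]
        exact orient_rim_upper hk hlt hj
    · refine separated_of_pos ?_ ?_
      · rw [orient_swap_right, neg_pos]; exact orient_hubs_right hk (by omega)
      · rw [orient_swap_right, ← orient_rotate, neg_pos]
        exact orient_rim_lower hk hlt hi (by omega)

/-- Among the rim edges only `2 3` and the long edge have ends on both sides of the hub axis, and
the long edge passes below both hubs. -/
theorem separated_hubs_rim {a b : ℕ} (h : RimEdge k a b) (hX : ¬(a = 2 ∧ b = 3)) :
    Separated (hubPoint k false) (hubPoint k true) (rimPoint a) (rimPoint b) := by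
  obtain ⟨h1, h2, h3⟩ := h
  by_cases hlong : a = 0 ∧ b + 1 = k
  · obtain ⟨rfl, hb⟩ := hlong
    exact (separated_of_pos (orient_longEdge_lower hk hb) (orient_rim_upper hk h1 h2)).symm
  · rcases lt_or_ge a 3 with ha | ha
    · exact separated_of_pos (orient_hubs_left hk (by omega)) (orient_hubs_left hk (by omega))
    · exact separated_of_neg (orient_hubs_right hk ha) (orient_hubs_right hk (by omega))

theorem orient_rim_hub_ne_zero {i j : ℕ} (hi : i < k) (hj : j < k) (hij : i ≠ j) (t : Bool) :
    orient (rimPoint i) (rimPoint j) (hubPoint k t) ≠ 0 := by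
  wlog hlt : i < j generalizing i j
  · rw [orient_swap]; exact neg_ne_zero.2 (this hj hi hij.symm (by omega))
  cases t
  · by_cases hlong : i = 0 ∧ j + 1 = k
    · obtain ⟨rfl, hb⟩ := hlong
      exact (orient_longEdge_lower hk hb).ne'
    · exact (orient_rim_lower hk hlt hj hlong).ne
  · exact (orient_rim_upper hk hlt hj).ne'

theorem orient_hubs_rim_ne_zero (i : ℕ) {s t : Bool} (hst : s ≠ t) :
    orient (hubPoint k s) (hubPoint k t) (rimPoint i) ≠ 0 := by
  have h : orient (hubPoint k false) (hubPoint k true) (rimPoint i) ≠ 0 := by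
    rcases lt_or_ge i 3 with hi | hi
    · exact (orient_hubs_left hk (by omega)).ne'
    · exact (orient_hubs_right hk hi).ne
  cases s <;> cases t
  · exact absurd rfl hst
  · exact h
  · rw [orient_swap]; exact neg_ne_zero.2 h
  · exact absurd rfl hst

end

/-- The inclusion of the integer grid into the plane. -/
def gridPoint (p : ℤ × ℤ) : ℝ × ℝ := (p.1, p.2)

theorem orient_gridPoint (a b c : ℤ × ℤ) :
    orient (gridPoint a) (gridPoint b) (gridPoint c) = (orient a b c : ℤ) := by
  simp only [orient, gridPoint]; push_cast; rfl

theorem gridPoint_injective : gridPoint.Injective := fun a b h => by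
  have h1 := congrArg Prod.fst h
  have h2 := congrArg Prod.snd h
  exact Prod.ext (Int.cast_injective h1) (Int.cast_injective h2)

theorem Separated.disjoint_segment {a b c d : ℤ × ℤ} (h : Separated a b c d) :
    Disjoint (segment ℝ (gridPoint a) (gridPoint b)) (segment ℝ (gridPoint c) (gridPoint d)) := by
  rcases h with h | h
  · refine disjoint_segment_of_same_side ?_
    rw [orient_gridPoint, orient_gridPoint]; exact_mod_cast h
  · refine (disjoint_segment_of_same_side ?_).symm
    rw [orient_gridPoint, orient_gridPoint]; exact_mod_cast h

theorem Opposite.gridPoint {a b c d : ℤ × ℤ} (h : Opposite a b c d) :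
    Opposite (gridPoint a) (gridPoint b) (gridPoint c) (gridPoint d) := by
  unfold Opposite
  simp only [orient_gridPoint]
  exact_mod_cast h

theorem opposite_lower {k : ℕ} (hk : 6 ≤ k) :
    Opposite (hubPoint k false) (rimPoint 1) (rimPoint 0) (rimPoint 2) := by
  have : (6 : ℤ) ≤ k := by omega
  constructor
  · refine mul_neg_of_pos_of_neg ?_ ?_ <;> simp [orient, rimPoint, hubPoint] <;> linarith
  · refine mul_neg_of_neg_of_pos ?_ ?_ <;> simp [orient, rimPoint, hubPoint]; linarith

theorem opposite_upper {k : ℕ} (hk : 6 ≤ k) :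
    Opposite (hubPoint k true) (rimPoint 4) (rimPoint 3) (rimPoint 5) := by
  have : (36 : ℤ) ≤ k ^ 2 := by
    have : (6 : ℤ) ≤ k := by omega
    nlinarith
  constructor
  · refine mul_neg_of_neg_of_pos ?_ ?_ <;> simp [orient, rimPoint, hubPoint] <;> linarith
  · refine mul_neg_of_pos_of_neg ?_ ?_ <;> simp [orient, rimPoint, hubPoint]; linarith

/-! ### Assembly of the drawing for an arbitrary pair of hubs. -/

section Wheel

variable {k : ℕ} (hk : 6 ≤ k) {W : Type} (e : W ≃ Bool)

/-- The positions of the vertices of the join of a graph on the rim with the two hubs. -/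
def wheelPoint (k : ℕ) (e : W ≃ Bool) : Fin k ⊕ W → ℤ × ℤ :=
  Sum.elim (fun i => rimPoint i) (fun w => hubPoint k (e w))

/-- The two crossings: the spoke from the lower hub to `1` crosses the chord `0 2`, and the spoke
from the upper hub to `4` crosses the chord `3 5`. -/
def wheelCrossing : Bool × Bool × Bool → Fin k ⊕ W
  | (false, false, false) => Sum.inr (e.symm false)
  | (false, false, true) => Sum.inl ⟨1, by omega⟩
  | (false, true, false) => Sum.inl ⟨0, by omega⟩
  | (false, true, true) => Sum.inl ⟨2, by omega⟩
  | (true, false, false) => Sum.inr (e.symm true)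
  | (true, false, true) => Sum.inl ⟨4, by omega⟩
  | (true, true, false) => Sum.inl ⟨3, by omega⟩
  | (true, true, true) => Sum.inl ⟨5, by omega⟩

/-- The edges `u v` and `w z` are separated, or form one of the two crossings. -/
def SeparatedOrCrossing (u v w z : Fin k ⊕ W) : Prop :=
  Separated (wheelPoint k e u) (wheelPoint k e v) (wheelPoint k e w) (wheelPoint k e z) ∨
    ∃ i b, s(u, v) = s(wheelCrossing hk e (i, b, false), wheelCrossing hk e (i, b, true)) ∧
      s(w, z) = s(wheelCrossing hk e (i, !b, false), wheelCrossing hk e (i, !b, true))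

variable {hk e}

theorem SeparatedOrCrossing.symm {u v w z : Fin k ⊕ W} (h : SeparatedOrCrossing hk e u v w z) :
    SeparatedOrCrossing hk e w z u v := by
  rcases h with h | ⟨i, b, h1, h2⟩
  · exact Or.inl h.symm
  · exact Or.inr ⟨i, !b, h2, by rwa [Bool.not_not]⟩

theorem SeparatedOrCrossing.swap {u v w z : Fin k ⊕ W} (h : SeparatedOrCrossing hk e u v w z) :
    SeparatedOrCrossing hk e v u w z := by
  rcases h with h | ⟨i, b, h1, h2⟩
  · exact Or.inl h.swap
  · exact Or.inr ⟨i, b, by rwa [Sym2.eq_swap], h2⟩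

theorem SeparatedOrCrossing.swap_right {u v w z : Fin k ⊕ W}
    (h : SeparatedOrCrossing hk e u v w z) : SeparatedOrCrossing hk e u v z w :=
  h.symm.swap.symm

theorem separatedOrCrossing_rim_rim {i j m n : Fin k} (h : RimEdge k i j ∨ RimEdge k j i)
    (h' : RimEdge k m n ∨ RimEdge k n m) (him : i ≠ m) (hin : i ≠ n) (hjm : j ≠ m)
    (hjn : j ≠ n) :
    SeparatedOrCrossing hk e (Sum.inl i) (Sum.inl j) (Sum.inl m) (Sum.inl n) := by
  wlog hij : RimEdge k i j generalizing i j
  · exact (this h.symm hjm hjn him hin (h.resolve_left hij)).swap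
  wlog hmn : RimEdge k m n generalizing m n
  · exact (this h'.symm hin him hjn hjm (h'.resolve_left hmn)).swap_right
  exact Or.inl (separated_rim_rim hk hij hmn (by omega) (by omega) (by omega) (by omega))

theorem separatedOrCrossing_hub_rim (w : W) {i a b : Fin k}
    (h : RimEdge k a b ∨ RimEdge k b a) (hia : i ≠ a) (hib : i ≠ b) :
    SeparatedOrCrossing hk e (Sum.inr w) (Sum.inl i) (Sum.inl a) (Sum.inl b) := by
  wlog hab : RimEdge k a b generalizing a b
  · exact (this h.symm hib hia (h.resolve_left hab)).swap_right
  obtain ⟨t, rfl⟩ := e.symm.surjective w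
  cases t
  · by_cases hX : (i : ℕ) = 1 ∧ (a : ℕ) = 0 ∧ (b : ℕ) = 2
    · obtain ⟨i, hi⟩ := i
      obtain ⟨a, ha⟩ := a
      obtain ⟨b, hb⟩ := b
      obtain ⟨rfl, rfl, rfl⟩ := hX
      exact Or.inr ⟨false, false, rfl, rfl⟩
    · refine Or.inl ?_
      simpa [wheelPoint] using separated_lower_rim hk i.2 hab (by omega) (by omega) hX
  · by_cases hX : (i : ℕ) = 4 ∧ (a : ℕ) = 3 ∧ (b : ℕ) = 5
    · obtain ⟨i, hi⟩ := i
      obtain ⟨a, ha⟩ := a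
      obtain ⟨b, hb⟩ := b
      obtain ⟨rfl, rfl, rfl⟩ := hX
      exact Or.inr ⟨true, false, rfl, rfl⟩
    · refine Or.inl ?_
      simpa [wheelPoint] using separated_upper_rim hk i.2 hab (by omega) (by omega) hX

theorem separatedOrCrossing_hub_hub {w w' : W} {i j : Fin k} (hw : w ≠ w') (hij : i ≠ j) :
    SeparatedOrCrossing hk e (Sum.inr w) (Sum.inl i) (Sum.inr w') (Sum.inl j) := by
  obtain ⟨t, rfl⟩ := e.symm.surjective w
  obtain ⟨t', rfl⟩ := e.symm.surjective w'
  wlog ht : t = false generalizing t t' i j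
  · refine (this hij.symm t' t hw.symm ?_).symm
    cases t <;> cases t' <;> simp_all
  subst ht
  obtain rfl : t' = true := by cases t' <;> simp_all
  refine Or.inl ?_
  simpa [wheelPoint] using separated_lower_upper hk i.2 j.2 (by omega)

theorem separatedOrCrossing_hubs_rim {w w' : W} {a b : Fin k} (hw : w ≠ w')
    (h : RimEdge k a b ∨ RimEdge k b a)
    (hX : s(a, b) ≠ s((⟨2, by omega⟩ : Fin k), ⟨3, by omega⟩)) :
    SeparatedOrCrossing hk e (Sum.inr w) (Sum.inr w') (Sum.inl a) (Sum.inl b) := by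
  wlog hab : RimEdge k a b generalizing a b
  · exact (this h.symm (by rwa [Sym2.eq_swap]) (h.resolve_left hab)).swap_right
  obtain ⟨t, rfl⟩ := e.symm.surjective w
  obtain ⟨t', rfl⟩ := e.symm.surjective w'
  wlog ht : t = false generalizing t t'
  · refine (this t' t hw.symm ?_).swap
    cases t <;> cases t' <;> simp_all
  subst ht
  obtain rfl : t' = true := by cases t' <;> simp_all
  have hX' : ¬((a : ℕ) = 2 ∧ (b : ℕ) = 3) := fun h =>
    hX (by rw [Fin.ext (b := ⟨2, by omega⟩) h.1, Fin.ext (b := ⟨3, by omega⟩) h.2])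
  refine Or.inl ?_
  simpa [wheelPoint] using separated_hubs_rim hk hab hX'

variable (hk e)

include hk in
theorem wheelPoint_injective : (wheelPoint k e).Injective := by
  have hrim : ∀ i : ℕ, (rimPoint i).1 = 2 * (i : ℤ) - 5 := fun i => by
    unfold rimPoint; split_ifs with h
    · subst h; rfl
    · rfl
  rintro (i | w) (j | w') h
  · have h1 : (rimPoint i).1 = (rimPoint j).1 := congrArg Prod.fst h
    rw [hrim, hrim] at h1
    exact congrArg Sum.inl (Fin.ext (by omega))
  · have h1 : (rimPoint i).1 = 0 := congrArg Prod.fst h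
    rw [hrim] at h1; omega
  · have h1 : 0 = (rimPoint j).1 := congrArg Prod.fst h
    rw [hrim] at h1; omega
  · have h1 : (hubPoint k (e w)).2 = (hubPoint k (e w')).2 := congrArg Prod.snd h
    have h2 : (4 * k ^ 2 : ℤ) ≠ 36 - 10 * k := by
      have : (6 : ℤ) ≤ k := by omega
      nlinarith
    refine congrArg Sum.inr (e.injective ?_)
    cases hw : e w <;> cases hw' : e w' <;> simp [hubPoint, hw, hw'] at h1 ⊢
    · exact h2 h1.symm
    · exact h2 h1

include e in
theorem not_three_hubs {x y z : W} (hxy : x ≠ y) (hxz : x ≠ z) (hyz : y ≠ z) : False := by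
  have := e.injective.ne hxy
  have := e.injective.ne hxz
  have := e.injective.ne hyz
  cases h1 : e x <;> cases h2 : e y <;> cases h3 : e z <;> simp_all

include hk in
theorem orient_wheelPoint_ne_zero {u v w : Fin k ⊕ W} (huv : u ≠ v) (huw : u ≠ w) (hvw : v ≠ w) :
    orient (wheelPoint k e u) (wheelPoint k e v) (wheelPoint k e w) ≠ 0 := by
  have rrh : ∀ {i j : Fin k} (t : W), i ≠ j →
      orient (rimPoint i) (rimPoint j) (hubPoint k (e t)) ≠ 0 := fun {i j} t hij =>
    orient_rim_hub_ne_zero hk i.2 j.2 (by omega) (e t)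
  have hhr : ∀ (i : Fin k) {s t : W}, s ≠ t →
      orient (hubPoint k (e s)) (hubPoint k (e t)) (rimPoint i) ≠ 0 := fun i {s t} hst =>
    orient_hubs_rim_ne_zero hk i (e.injective.ne hst)
  rcases u with i | x <;> rcases v with j | y <;> rcases w with l | z <;>
    simp only [ne_eq, Sum.inl.injEq, Sum.inr.injEq] at huv huw hvw <;>
    simp only [wheelPoint, Sum.elim_inl, Sum.elim_inr]
  · exact orient_rim_ne_zero (by omega) (by omega) (by omega)
  · exact rrh z huv
  · rw [orient_swap_right]; exact neg_ne_zero.2 (rrh y huw)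
  · rw [← orient_rotate]; exact hhr i hvw
  · rw [← orient_rotate]; exact rrh x hvw
  · rw [← orient_rotate, ← orient_rotate]; exact hhr j (Ne.symm huw)
  · exact hhr l huv
  · exact (not_three_hubs e huv huw hvw).elim

/-- The straight line drawing of the join of a subgraph of the rim with the two hubs. -/
theorem straightC0_wheel {G : SimpleGraph (Fin k)} {H : SimpleGraph W}
    (hG : ∀ i j, G.Adj i j → RimEdge k i j ∨ RimEdge k j i)
    -- The edge `2 3` is forbidden only when the hubs are adjacent, so one construction serves both
    -- `2P₁` and `P₂`.
    (hH : ∀ w w', H.Adj w w' → s(⟨2, by omega⟩, ⟨3, by omega⟩) ∉ G.edgeSet) :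
    StraightC0 (join G H) (fun v => gridPoint (wheelPoint k e v)) (wheelCrossing hk e) where
  injective := gridPoint_injective.comp (wheelPoint_injective hk e)
  injective_crossing := by
    rintro ⟨_ | _, _ | _, _ | _⟩ ⟨_ | _, _ | _, _ | _⟩ h <;> simp [wheelCrossing] at h ⊢
  orient_ne_zero u v w huv huw hvw := by
    rw [orient_gridPoint]
    exact Int.cast_ne_zero.2 (orient_wheelPoint_ne_zero hk e huv huw hvw)
  opposite i := by
    apply Opposite.gridPoint
    cases i
    · simpa [wheelPoint, wheelCrossing] using opposite_lower hk
    · simpa [wheelPoint, wheelCrossing] using opposite_upper hk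
  disjoint_or u v w z huv hwz huw huz hvw hvz := by
    suffices h : SeparatedOrCrossing hk e u v w z from h.imp_left Separated.disjoint_segment
    have rr : ∀ {i j}, (join G H).Adj (Sum.inl i) (Sum.inl j) → RimEdge k i j ∨ RimEdge k j i :=
      fun h => hG _ _ (by simpa [join] using h)
    have hX : ∀ {x y a b}, (join G H).Adj (Sum.inr x) (Sum.inr y) →
        (join G H).Adj (Sum.inl a) (Sum.inl b) →
        s(a, b) ≠ s((⟨2, by omega⟩ : Fin k), ⟨3, by omega⟩) := fun {x y a b} hxy hab h => by
      refine hH x y (by simpa [join] using hxy) (h ▸ (SimpleGraph.mem_edgeSet G).2 ?_)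
      simpa [join] using hab
    have hne := huv.ne
    have hne' := hwz.ne
    rcases u with i | x <;> rcases v with j | y <;> rcases w with l | p <;> rcases z with m | q <;>
      simp only [ne_eq, Sum.inl.injEq, Sum.inr.injEq] at huw huz hvw hvz hne hne'
    · exact separatedOrCrossing_rim_rim (rr huv) (rr hwz) huw huz hvw hvz
    · exact (separatedOrCrossing_hub_rim q (rr huv) (Ne.symm huw) (Ne.symm hvw)).symm.swap_right
    · exact (separatedOrCrossing_hub_rim p (rr huv) (Ne.symm huz) (Ne.symm hvz)).symm
    · exact (separatedOrCrossing_hubs_rim hne' (rr huv) (hX hwz huv)).symm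
    · exact (separatedOrCrossing_hub_rim y (rr hwz) huw huz).swap
    · exact (separatedOrCrossing_hub_hub hvz huw).swap.swap_right
    · exact (separatedOrCrossing_hub_hub hvw huz).swap
    · exact (not_three_hubs e hvw hvz hne').elim
    · exact separatedOrCrossing_hub_rim x (rr hwz) hvw hvz
    · exact (separatedOrCrossing_hub_hub huz hvw).swap_right
    · exact separatedOrCrossing_hub_hub huw hvz
    · exact (not_three_hubs e huw huz hne').elim
    · exact separatedOrCrossing_hubs_rim hne (rr hwz) (hX huv hwz)
    · exact (not_three_hubs e huz hne (Ne.symm hvz)).elim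
    · exact (not_three_hubs e huw hne (Ne.symm hvw)).elim
    · exact (not_three_hubs e huw huz hne').elim

end Wheel

/-! ### Adjacency and maximum degree of the two rim graphs. -/

section

variable {k : ℕ} (hk : 6 ≤ k)

theorem cycleWithChords_adj_of_lt {i j : Fin k} (hij : (i : ℕ) < j) :
    (cycleWithChords k hk).Adj i j ↔ RimEdge k i j := by
  have hc : (SimpleGraph.cycleGraph k).Adj i j ↔
      (j : ℕ) = i + 1 ∨ ((i : ℕ) = 0 ∧ (j : ℕ) + 1 = k) := by
    rw [SimpleGraph.cycleGraph_adj', Fin.coe_sub_iff_lt.2 (Fin.lt_def.2 hij),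
      Fin.coe_sub_iff_le.2 (Fin.le_def.2 hij.le)]
    omega
  simp only [cycleWithChords, SimpleGraph.sup_adj, hc, SimpleGraph.edge_adj, RimEdge,
    Fin.ext_iff, ne_eq]
  omega

theorem cycleWithChords_adj {i j : Fin k} :
    (cycleWithChords k hk).Adj i j ↔ RimEdge k i j ∨ RimEdge k j i := by
  rcases lt_trichotomy (i : ℕ) j with h | h | h
  · rw [cycleWithChords_adj_of_lt hk h, or_iff_left]
    exact fun h' => h'.1.not_gt h
  · obtain rfl := Fin.ext h
    simp [RimEdge]
  · rw [SimpleGraph.adj_comm, cycleWithChords_adj_of_lt hk h, or_iff_right]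
    exact fun h' => h'.1.not_gt h

theorem cycleWithChordsMinus_adj {i j : Fin k} :
    (cycleWithChordsMinus k hk).Adj i j ↔ (RimEdge k i j ∨ RimEdge k j i) ∧
      s(i, j) ≠ s(⟨2, by omega⟩, ⟨3, by omega⟩) := by
  simp only [cycleWithChordsMinus, SimpleGraph.deleteEdges_adj, cycleWithChords_adj,
    Set.mem_singleton_iff, ne_eq]

include hk in
/-- A graph on the rim which keeps the three edges at the vertex `0` has maximum degree three. -/
theorem maxDegree_eq_three {G : SimpleGraph (Fin k)} [DecidableRel G.Adj]
    (hG : ∀ i j, G.Adj i j → RimEdge k i j ∨ RimEdge k j i)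
    (h0 : ∀ j : Fin k, RimEdge k 0 j → G.Adj ⟨0, by omega⟩ j) : G.maxDegree = 3 := by
  refine le_antisymm (G.maxDegree_le_of_forall_degree_le 3 fun i => ?_) ?_
  · let N : Finset ℕ := {if (i : ℕ) + 1 = k then 0 else (i : ℕ) + 1,
      if (i : ℕ) = 0 then k - 1 else (i : ℕ) - 1,
      if (i : ℕ) = 0 then 2 else if (i : ℕ) = 2 then 0 else if (i : ℕ) = 3 then 5 else 3}
    have hN : N.card ≤ 3 := Finset.card_le_three
    refine le_trans ?_ hN
    rw [← G.card_neighborFinset_eq_degree]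
    refine Finset.card_le_card_of_injOn Fin.val (fun j hj => ?_) Fin.val_injective.injOn
    have h := hG i j (by simpa using hj)
    simp only [N, Finset.coe_insert, Finset.coe_singleton, Set.mem_insert_iff,
      Set.mem_singleton_iff]
    simp only [RimEdge] at h
    split_ifs <;> omega
  · refine le_trans ?_ (G.degree_le_maxDegree ⟨0, by omega⟩)
    rw [← G.card_neighborFinset_eq_degree]
    have hc : ({⟨1, by omega⟩, ⟨2, by omega⟩, ⟨k - 1, by omega⟩} : Finset (Fin k)).card = 3 := by
      rw [Finset.card_eq_three]
      refine ⟨_, _, _, ?_, ?_, ?_, rfl⟩ <;> simp only [ne_eq, Fin.ext_iff] <;> omega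
    rw [← hc]
    refine Finset.card_le_card fun j hj => ?_
    rw [SimpleGraph.mem_neighborFinset]
    refine h0 j ?_
    simp only [Finset.mem_insert, Finset.mem_singleton, Fin.ext_iff] at hj
    exact ⟨by omega, j.2, by omega⟩

end

/-- The hubs of `2P₁`. -/
def twoP1Equiv : Fin 1 ⊕ Fin 1 ≃ Bool :=
  finSumFinEquiv.trans finTwoEquiv

end OnePlanar

theorem mainTheorem5 :
    (∀ {V : Type*} [Fintype V] (G : SimpleGraph V) [DecidableRel G.Adj],
      (OnePlanar.ClassC0 (OnePlanar.join G OnePlanar.twoP1) ∨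
        OnePlanar.ClassC0 (OnePlanar.join G OnePlanar.P2)) → G.maxDegree ≤ 3) ∧
    (∀ (k : ℕ) (hk : 6 ≤ k) [DecidableRel (OnePlanar.cycleWithChords k hk).Adj],
      (OnePlanar.cycleWithChords k hk).maxDegree = 3 ∧
        OnePlanar.ClassC0 (OnePlanar.join (OnePlanar.cycleWithChords k hk) OnePlanar.twoP1)) ∧
    (∀ (k : ℕ) (hk : 6 ≤ k) [DecidableRel (OnePlanar.cycleWithChordsMinus k hk).Adj],
      (OnePlanar.cycleWithChordsMinus k hk).maxDegree = 3 ∧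
        OnePlanar.ClassC0 (OnePlanar.join (OnePlanar.cycleWithChordsMinus k hk) OnePlanar.P2)) := by
  refine ⟨fun {V} _ G _ h => ?_, fun k hk _ => ⟨?_, ?_⟩, fun k hk _ => ⟨?_, ?_⟩⟩
  · rcases h with h | h
    · exact OnePlanar.maxDegree_le_three_of_join G _ (Sum.inl 0) (Sum.inr 0) (by simp) h
    · exact OnePlanar.maxDegree_le_three_of_join G _ 0 1 (by decide) h
  · exact OnePlanar.maxDegree_eq_three hk (fun i j => (OnePlanar.cycleWithChords_adj hk).1)
      fun j hj => (OnePlanar.cycleWithChords_adj hk).2 (Or.inl hj)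
  · refine (OnePlanar.straightC0_wheel hk OnePlanar.twoP1Equiv
      (fun i j => (OnePlanar.cycleWithChords_adj hk).1) fun w w' h => ?_).classC0
    rcases w with w | w <;> rcases w' with w' | w' <;>
      simp [OnePlanar.twoP1, Subsingleton.elim w w'] at h
  · refine OnePlanar.maxDegree_eq_three hk
      (fun i j h => ((OnePlanar.cycleWithChordsMinus_adj hk).1 h).1)
      fun j hj => (OnePlanar.cycleWithChordsMinus_adj hk).2 ⟨Or.inl hj, fun h => ?_⟩
    rcases Sym2.eq_iff.1 h with h | h <;> simp at h
  · refine (OnePlanar.straightC0_wheel hk finTwoEquiv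
      (fun i j h => ((OnePlanar.cycleWithChordsMinus_adj hk).1 h).1) fun w w' _ h => ?_).classC0
    exact ((OnePlanar.cycleWithChordsMinus_adj hk).1 ((SimpleGraph.mem_edgeSet _).1 h)).2 rfl
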